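/- Let $0 < a < b < \infty$ and let $M \ge 1$ be an integer. Let $W$ be a bounded nondecreasing real function on $[a,b]$ with at least $M+1$ points of increase in $[a,b]$, that is, points $c \in [a,b]$ such that for every $\varepsilon > 0$ there are $s, t \in [a,b]$ with $c - \varepsilon < s \le c \le t < c + \varepsilon$ and $W(s) < W(t)$. Let $$f(x) = \int_a^b e^{-xt}\, dW(t), \qquad 0 \le x < \infty,$$ as a Riemann--Stieltjes integral. Let $$\mathcal{E}_M = \Big\{ g : \mathbb{R} \to \mathbb{R} \;\Big|\; g(x) = \sum_{\nu=1}^M c_\nu e^{-t_\nu x},\ c_\nu, t_\nu \in \mathbb{R} \Big\}$$ be the set of real exponential sums with at most $M$ terms, and let $$\operatorname{dist}(f, \mathcal{E}_M, [0,\infty)) = \inf_{g \in \mathcal{E}_M} \ \sup_{0 \le x < \infty} |f(x) - g(x)|.$$ Then $$0 < \operatorname{dist}(f, \mathcal{E}_M, [0,\infty)) < \frac{16}{\pi}\, \rho^{-2M} f(0), \qquad \rho = \exp\!\left( \pi\, \frac{K(a/b)}{K\big(\sqrt{1 - (a/b)^2}\big)} \right),$$ where $K(k) = \int_0^{\pi/2}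 \frac{d\theta}{\sqrt{1 - k^2 \sin^2\theta}}$ is the complete elliptic integral of the first kind with modulus $k$. -/

import Mathlib

open scoped ENNReal

/-- The complete elliptic integral of the first kind with modulus `k`. -/
noncomputable def ellipticK (k : ℝ) : ℝ :=
  ∫ θ in (0 : ℝ)..(Real.pi / 2), 1 / Real.sqrt (1 - k ^ 2 * Real.sin θ ^ 2)

/-- `HasStieltjesIntegral φ α a b I` says that the Riemann-Stieltjes integral of `φ` with
respect to `α` over `[a, b]` exists and equals `I`: the sums
`∑ φ (ξ i) (α (t (i + 1)) - α (t i))` over tagged partitions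
`a = t 0 ≤ t 1 ≤ ⋯ ≤ t n = b`, `t i ≤ ξ i ≤ t (i + 1)`, tend to `I` as the mesh tends to `0`. -/
def HasStieltjesIntegral (φ α : ℝ → ℝ) (a b I : ℝ) : Prop :=
  ∀ ε : ℝ, 0 < ε → ∃ δ : ℝ, 0 < δ ∧
    ∀ (n : ℕ) (t ξ : ℕ → ℝ), t 0 = a → t n = b →
      (∀ i < n, t i ≤ ξ i ∧ ξ i ≤ t (i + 1) ∧ t (i + 1) - t i < δ) →
      |∑ i ∈ Finset.range n, φ (ξ i) * (α (t (i + 1)) - α (t i)) - I| < ε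

/-- The points of increase in `[a, b]` of a nondecreasing function `W` on `[a, b]`: every
neighbourhood of the point contains points of `[a, b]` on both sides (one-sidedly at an end point
of `[a, b]`) between which `W` strictly increases. -/
def pointsOfIncrease (W : ℝ → ℝ) (a b : ℝ) : Set ℝ :=
  {c | c ∈ Set.Icc a b ∧ ∀ ε : ℝ, 0 < ε →
    ∃ s ∈ Set.Icc a b, ∃ t ∈ Set.Icc a b,
      c - ε < s ∧ s ≤ c ∧ c ≤ t ∧ t < c + ε ∧ W s < W t}

/-- The set of real exponential sums `x ↦ ∑ c ν * exp (-(t ν * x))` with at most `M` terms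
(coefficients may vanish and exponents may coincide). -/
def expSums (M : ℕ) : Set (ℝ → ℝ) :=
  {g | ∃ c t : Fin M → ℝ, ∀ x : ℝ, g x = ∑ ν, c ν * Real.exp (-(t ν * x))}

/-- The best uniform approximation error `inf_{G ∈ 𝓖} sup_{x ∈ X} |F x - G x|`, taken in
`[0, ∞]` since the supremum may be infinite for some `G`. -/
noncomputable def bestUniformError (F : ℝ → ℝ) (𝓖 : Set (ℝ → ℝ)) (X : Set ℝ) : ℝ≥0∞ :=
  ⨅ G ∈ 𝓖, ⨆ x ∈ X, ENNReal.ofReal |F x - G x|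

/-- The elliptic integral `∫ dθ / √(b² cos² θ + a² sin² θ)` over a quarter period. -/
noncomputable def agmIntegral (a b : ℝ) : ℝ :=
  ∫ θ in (0 : ℝ)..(Real.pi / 2), 1 / Real.sqrt (b ^ 2 * Real.cos θ ^ 2 + a ^ 2 * Real.sin θ ^ 2)

lemma cos_sin_form_pos {p q : ℝ} (hp : 0 < p) (hq : 0 < q) (θ : ℝ) :
    0 < p * Real.cos θ ^ 2 + q * Real.sin θ ^ 2 := by
  have h := Real.sin_sq_add_cos_sq θ
  rcases eq_or_ne (Real.cos θ) 0 with h0 | h0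
  · rw [h0] at h ⊢
    nlinarith
  · have : 0 < Real.cos θ ^ 2 := by positivity
    have : 0 ≤ Real.sin θ ^ 2 := by positivity
    positivity

lemma continuous_agmIntegrand {a b : ℝ} (ha : 0 < a) (hb : 0 < b) :
    Continuous fun θ : ℝ =>
      1 / Real.sqrt (b ^ 2 * Real.cos θ ^ 2 + a ^ 2 * Real.sin θ ^ 2) := by
  refine Continuous.div (by fun_prop) (by fun_prop) fun θ => ?_
  exact (Real.sqrt_pos.2 (cos_sin_form_pos (by positivity) (by positivity) θ)).ne'

lemma agmIntegral_pos {a b : ℝ} (ha : 0 < a) (hb : 0 < b) : 0 < agmIntegral a b := by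
  refine intervalIntegral.intervalIntegral_pos_of_pos
    ((continuous_agmIntegrand ha hb).intervalIntegrable _ _) (fun θ => ?_) (by positivity)
  have := Real.sqrt_pos.2 (cos_sin_form_pos (p := b ^ 2) (q := a ^ 2)
    (by positivity) (by positivity) θ)
  positivity

lemma agmIntegral_mul {a b c : ℝ} (hc : 0 < c) :
    agmIntegral (c * a) (c * b) = c⁻¹ * agmIntegral a b := by
  unfold agmIntegral
  rw [← intervalIntegral.integral_const_mul]
  congr 1
  ext θ
  rw [show (c * b) ^ 2 * Real.cos θ ^ 2 + (c * a) ^ 2 * Real.sin θ ^ 2 =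
    c ^ 2 * (b ^ 2 * Real.cos θ ^ 2 + a ^ 2 * Real.sin θ ^ 2) by ring,
    Real.sqrt_mul (by positivity), Real.sqrt_sq hc.le]
  field_simp

lemma integral_agmIntegrand_zero_pi {a b : ℝ} (ha : 0 < a) (hb : 0 < b) :
    ∫ θ in (0 : ℝ)..Real.pi,
      1 / Real.sqrt (b ^ 2 * Real.cos θ ^ 2 + a ^ 2 * Real.sin θ ^ 2) = 2 * agmIntegral a b := by
  have hc := continuous_agmIntegrand ha hb
  rw [← intervalIntegral.integral_add_adjacent_intervals
    (hc.intervalIntegrable 0 (Real.pi / 2)) (hc.intervalIntegrable (Real.pi / 2) Real.pi)]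
  have : ∫ θ in (Real.pi / 2)..Real.pi,
      1 / Real.sqrt (b ^ 2 * Real.cos θ ^ 2 + a ^ 2 * Real.sin θ ^ 2) = agmIntegral a b := by
    have h := intervalIntegral.integral_comp_sub_left (a := 0) (b := Real.pi / 2)
      (fun θ => 1 / Real.sqrt (b ^ 2 * Real.cos θ ^ 2 + a ^ 2 * Real.sin θ ^ 2)) Real.pi
    simp only [Real.cos_pi_sub, Real.sin_pi_sub, neg_sq, sub_zero] at h
    rw [show Real.pi - Real.pi / 2 = Real.pi / 2 by ring] at h
    exact h.symm
  rw [this, agmIntegral]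
  ring

/-- Gauss's invariance of the elliptic integral under the arithmetic-geometric mean step. -/
lemma agmIntegral_agm {a b : ℝ} (ha : 0 < a) (hb : 0 < b) :
    agmIntegral (Real.sqrt (a * b)) ((a + b) / 2) = agmIntegral a b := by
  have hg : 0 < Real.sqrt (a * b) := by positivity
  have hm : 0 < (a + b) / 2 := by positivity
  set D : ℝ → ℝ := fun θ => b * Real.cos θ ^ 2 + a * Real.sin θ ^ 2 with hD
  set N : ℝ → ℝ := fun θ => b ^ 2 * Real.cos θ ^ 2 + a ^ 2 * Real.sin θ ^ 2 with hN
  have hDpos : ∀ θ, 0 < D θ := cos_sin_form_pos hb ha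
  have hNpos : ∀ θ, 0 < N θ := cos_sin_form_pos (by positivity) (by positivity)
  set y : ℝ → ℝ := fun θ => (b - a) * (Real.sin θ * Real.cos θ) / D θ with hy
  have hy2 : ∀ θ, 1 + y θ ^ 2 = N θ / D θ ^ 2 := by
    intro θ
    have h1 := Real.sin_sq_add_cos_sq θ
    have h2 : Real.cos θ ^ 2 = 1 - Real.sin θ ^ 2 := by linarith
    have := (hDpos θ).ne'
    simp only [hy]
    field_simp
    simp only [hD, hN, h2]
    ring
  set F : ℝ → ℝ := fun θ => 2 * θ - Real.arctan (y θ) with hF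
  set F' : ℝ → ℝ := fun θ => (a + b) * D θ / N θ with hF'
  have hderiv : ∀ θ, HasDerivAt F (F' θ) θ := by
    intro θ
    have hs := Real.hasDerivAt_sin θ
    have hc := Real.hasDerivAt_cos θ
    have hD' : HasDerivAt D (b * (2 * Real.cos θ * -Real.sin θ) +
        a * (2 * Real.sin θ * Real.cos θ)) θ := by
      have := ((hc.pow 2).const_mul b).add ((hs.pow 2).const_mul a)
      exact this.congr_deriv (by norm_num)
    have hy' := ((hs.mul hc).const_mul (b - a)).div hD' (hDpos θ).ne'
    have h := ((hasDerivAt_id θ).const_mul 2).sub hy'.arctan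
    refine h.congr_deriv ?_
    have e : 1 + ((b - a) * (Real.sin θ * Real.cos θ) / D θ) ^ 2 = N θ / D θ ^ 2 := hy2 θ
    have h1 := Real.sin_sq_add_cos_sq θ
    have h2 : Real.cos θ ^ 2 = 1 - Real.sin θ ^ 2 := by linarith
    have hDn := (hDpos θ).ne'
    have hNn := (hNpos θ).ne'
    simp only [Pi.mul_apply, Pi.div_apply]
    rw [e]
    simp only [hF']
    field_simp
    have h3 : Real.cos θ ^ 3 = Real.cos θ * (1 - Real.sin θ ^ 2) := by rw [← h2]; ring
    have h4 : Real.cos θ ^ 4 = (1 - Real.sin θ ^ 2) ^ 2 := by rw [← h2]; ring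
    simp only [hD, hN]
    ring_nf
    simp only [h2, h4]
    ring
  have hcont : Continuous F' := by
    refine Continuous.div (by fun_prop) (by fun_prop) fun θ => (hNpos θ).ne'
  have hsub := intervalIntegral.integral_comp_mul_deriv (a := 0) (b := Real.pi / 2)
    (fun θ _ => hderiv θ) hcont.continuousOn (continuous_agmIntegrand hg hm)
  have hF0 : F 0 = 0 := by simp [hF, hy]
  have hFpi : F (Real.pi / 2) = Real.pi := by simp [hF, hy]; ring
  rw [hF0, hFpi, integral_agmIntegrand_zero_pi hg hm] at hsub
  have hpt : ∀ θ, ((fun φ => 1 / Real.sqrt (((a + b) / 2) ^ 2 * Real.cos φ ^ 2 +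
      Real.sqrt (a * b) ^ 2 * Real.sin φ ^ 2)) ∘ F) θ * F' θ =
      2 * (1 / Real.sqrt (N θ)) := by
    intro θ
    have hDn := (hDpos θ)
    have hNn := (hNpos θ)
    have h1 := Real.sin_sq_add_cos_sq θ
    have h2 : Real.cos θ ^ 2 = 1 - Real.sin θ ^ 2 := by linarith
    have hcosF : Real.cos (F θ) ^ 2 = (b * Real.cos θ ^ 2 - a * Real.sin θ ^ 2) ^ 2 / N θ := by
      have e1 : Real.sqrt (1 + y θ ^ 2) = Real.sqrt (N θ) / D θ := by
        rw [hy2, Real.sqrt_div hNn.le, Real.sqrt_sq hDn.le]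
      have hsN := Real.sqrt_pos.2 hNn
      simp only [hF]
      rw [Real.cos_sub, Real.cos_arctan, Real.sin_arctan, e1, Real.cos_two_mul, Real.sin_two_mul]
      have e2 : (2 * Real.cos θ ^ 2 - 1) * (1 / (Real.sqrt (N θ) / D θ)) +
          2 * Real.sin θ * Real.cos θ * (y θ / (Real.sqrt (N θ) / D θ)) =
          (b * Real.cos θ ^ 2 - a * Real.sin θ ^ 2) / Real.sqrt (N θ) := by
        simp only [hy]
        field_simp
        simp only [hD]
        ring_nf
        have h4 : Real.cos θ ^ 4 = (1 - Real.sin θ ^ 2) ^ 2 := by rw [← h2]; ring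
        simp only [h2, h4]
        ring
      rw [e2, div_pow, Real.sq_sqrt hNn.le]
    have hsinF : Real.sin (F θ) ^ 2 = 1 - Real.cos (F θ) ^ 2 := Real.sin_sq _
    have key : ((a + b) / 2) ^ 2 * Real.cos (F θ) ^ 2 +
        Real.sqrt (a * b) ^ 2 * Real.sin (F θ) ^ 2 =
        ((a + b) * D θ) ^ 2 / 2 ^ 2 / N θ := by
      rw [hsinF, hcosF, Real.sq_sqrt (by positivity)]
      field_simp
      simp only [hD, hN]
      have h4 : Real.cos θ ^ 4 = (1 - Real.sin θ ^ 2) ^ 2 := by rw [← h2]; ring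
      ring_nf
      simp only [h2, h4]
      ring
    simp only [Function.comp]
    rw [key, Real.sqrt_div (by positivity), ← div_pow, Real.sqrt_sq (by positivity)]
    simp only [hF']
    have hsN := Real.sqrt_pos.2 hNn
    nth_rewrite 2 [← Real.sq_sqrt hNn.le]
    have : a + b ≠ 0 := by positivity
    field_simp
  simp only [hpt, intervalIntegral.integral_const_mul] at hsub
  change 2 * agmIntegral a b = _ at hsub
  linarith

lemma ellipticK_compl {a b : ℝ} (ha : 0 < a) (hab : a < b) :
    ellipticK (Real.sqrt (1 - (a / b) ^ 2)) = b * agmIntegral a b := by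
  have hb : 0 < b := ha.trans hab
  have h1 : (a / b) ^ 2 ≤ 1 := by
    rw [div_pow, div_le_one (by positivity)]; gcongr
  unfold ellipticK agmIntegral
  rw [← intervalIntegral.integral_const_mul, Real.sq_sqrt (by linarith)]
  congr 1
  ext θ
  rw [show 1 - (1 - (a / b) ^ 2) * Real.sin θ ^ 2 =
    (b ^ 2 * Real.cos θ ^ 2 + a ^ 2 * Real.sin θ ^ 2) / b ^ 2 by
      rw [Real.cos_sq']; field_simp; ring, Real.sqrt_div' _ (by positivity), Real.sqrt_sq hb.le]
  field_simp

lemma ellipticK_eq_agmIntegral {a b : ℝ} (ha : 0 < a) (hab : a < b) :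
    ellipticK (a / b) = b * agmIntegral (b - a) (b + a) := by
  have hb : 0 < b := ha.trans hab
  have h := agmIntegral_agm (sub_pos.2 hab) (add_pos hb ha)
  rw [← h]
  unfold ellipticK agmIntegral
  rw [← intervalIntegral.integral_const_mul]
  congr 1
  ext θ
  rw [Real.sq_sqrt (by have := sub_pos.2 hab; positivity)]
  rw [show 1 - (a / b) ^ 2 * Real.sin θ ^ 2 =
    (((b - a + (b + a)) / 2) ^ 2 * Real.cos θ ^ 2 + (b - a) * (b + a) * Real.sin θ ^ 2) / b ^ 2 by
      rw [Real.cos_sq']; field_simp; ring, Real.sqrt_div' _ (by positivity), Real.sqrt_sq hb.le]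
  field_simp

/-- The logarithm of the decay rate, `π K(a/b) / K(√(1 - (a/b)²))`. -/
noncomputable def decayRate (a b : ℝ) : ℝ :=
  Real.pi * (ellipticK (a / b) / ellipticK (Real.sqrt (1 - (a / b) ^ 2)))

lemma decayRate_eq {a b : ℝ} (ha : 0 < a) (hab : a < b) :
    decayRate a b = Real.pi * (agmIntegral (b - a) (b + a) / agmIntegral a b) := by
  have hb : b ≠ 0 := (ha.trans hab).ne'
  rw [decayRate, ellipticK_eq_agmIntegral ha hab, ellipticK_compl ha hab,
    mul_div_mul_left _ _ hb]

lemma decayRate_pos {a b : ℝ} (ha : 0 < a) (hab : a < b) : 0 < decayRate a b := by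
  rw [decayRate_eq ha hab]
  have := agmIntegral_pos (sub_pos.2 hab) (add_pos (ha.trans hab) ha)
  have := agmIntegral_pos ha (ha.trans hab)
  positivity

lemma sqrt_mul_lt_mean {a b : ℝ} (ha : 0 < a) (hab : a < b) :
    Real.sqrt (a * b) < (a + b) / 2 := by
  rw [Real.sqrt_lt' (by linarith)]
  nlinarith [sq_pos_of_pos (sub_pos.2 hab)]

lemma decayRate_agm {a b : ℝ} (ha : 0 < a) (hab : a < b) :
    decayRate (Real.sqrt (a * b)) ((a + b) / 2) = 2 * decayRate a b := by
  have hb : 0 < b := ha.trans hab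
  have hg : 0 < Real.sqrt (a * b) := by positivity
  have hlt := sqrt_mul_lt_mean ha hab
  rw [decayRate_eq hg hlt, decayRate_eq ha hab, agmIntegral_agm ha hb]
  have hs2 : Real.sqrt (a * b) ^ 2 = a * b := Real.sq_sqrt (by positivity)
  have h := agmIntegral_agm (sub_pos.2 hlt) (add_pos (hg.trans hlt) hg)
  have e1 : Real.sqrt (((a + b) / 2 - Real.sqrt (a * b)) * ((a + b) / 2 + Real.sqrt (a * b))) =
      2⁻¹ * (b - a) := by
    rw [show ((a + b) / 2 - Real.sqrt (a * b)) * ((a + b) / 2 + Real.sqrt (a * b)) =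
      (2⁻¹ * (b - a)) ^ 2 by ring_nf; rw [hs2]; ring, Real.sqrt_sq (by linarith)]
  have e2 : ((a + b) / 2 - Real.sqrt (a * b) + ((a + b) / 2 + Real.sqrt (a * b))) / 2 =
      2⁻¹ * (b + a) := by ring
  rw [e1, e2, agmIntegral_mul (by norm_num)] at h
  rw [← h]
  field_simp

lemma ellipticK_le {k : ℝ} (hk0 : 0 < k) (hk1 : k < 1) :
    k * ellipticK k ≤ Real.log ((1 + k) / (1 - k)) / 2 + Real.pi / 2 := by
  set k' : ℝ := Real.sqrt (1 - k ^ 2) with hk'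
  have hpos : 0 < 1 - k ^ 2 := by nlinarith
  have hk'0 : 0 < k' := Real.sqrt_pos.2 hpos
  have hk'2 : k' ^ 2 = 1 - k ^ 2 := Real.sq_sqrt hpos.le
  set D : ℝ → ℝ := fun θ => 1 - k ^ 2 * Real.sin θ ^ 2 with hD
  have hDpos : ∀ θ, 0 < D θ := by
    intro θ
    have := Real.sin_sq_le_one θ
    simp only [hD]
    nlinarith [sq_nonneg k]
  set G : ℝ → ℝ := fun θ => (Real.log (1 + k * Real.sin θ) - Real.log (1 - k * Real.sin θ)) / 2 -
    Real.arctan (k * Real.cos θ / k') with hG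
  have hGd : ∀ θ, HasDerivAt G (k * ((Real.cos θ + k' * Real.sin θ) / D θ)) θ := by
    intro θ
    have h1 : 0 < 1 + k * Real.sin θ := by nlinarith [Real.neg_one_le_sin θ]
    have h2 : 0 < 1 - k * Real.sin θ := by nlinarith [Real.sin_le_one θ]
    have hs := (Real.hasDerivAt_sin θ).const_mul k
    have hc := ((Real.hasDerivAt_cos θ).const_mul k).div_const k'
    have h := (((hs.const_add 1).log h1.ne').sub ((hs.const_sub 1).log h2.ne')).div_const 2 |>.sub
      hc.arctan
    refine h.congr_deriv ?_
    have hDn := (hDpos θ).ne'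
    have e : 1 + (k * Real.cos θ / k') ^ 2 = D θ / k' ^ 2 := by
      rw [div_pow, mul_pow, Real.cos_sq']
      field_simp
      rw [hk'2]
      simp only [hD]
      ring
    have e2 : D θ = (1 + k * Real.sin θ) * (1 - k * Real.sin θ) := by
      simp only [hD]; ring
    rw [e]
    rw [e2]
    field_simp
    ring
  have hcont : Continuous fun θ => k * ((Real.cos θ + k' * Real.sin θ) / D θ) :=
    continuous_const.mul (Continuous.div (by fun_prop) (by fun_prop) fun θ => (hDpos θ).ne')
  have hint := intervalIntegral.integral_eq_sub_of_hasDerivAt (a := 0) (b := Real.pi / 2)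
    (fun θ _ => hGd θ) (hcont.intervalIntegrable _ _)
  have hle : k * ellipticK k ≤ G (Real.pi / 2) - G 0 := by
    rw [← hint, ellipticK, ← intervalIntegral.integral_const_mul]
    have hc2 : Continuous fun θ => k * (1 / Real.sqrt (D θ)) :=
      continuous_const.mul (Continuous.div (by fun_prop) (by fun_prop)
        fun θ => (Real.sqrt_pos.2 (hDpos θ)).ne')
    refine intervalIntegral.integral_mono_on (by positivity) (hc2.intervalIntegrable _ _)
      (hcont.intervalIntegrable _ _) fun θ hθ => ?_
    have hs : 0 ≤ Real.sin θ := Real.sin_nonneg_of_nonneg_of_le_pi hθ.1 (by linarith [hθ.2, Real.pi_pos])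
    have hc : 0 ≤ Real.cos θ := Real.cos_nonneg_of_neg_pi_div_two_le_of_le
      (by linarith [hθ.1, Real.pi_pos]) hθ.2
    have hsq : Real.sqrt (D θ) ≤ Real.cos θ + k' * Real.sin θ := by
      apply Real.sqrt_le_iff.2 ⟨by positivity, ?_⟩
      have : 0 ≤ 2 * Real.cos θ * (k' * Real.sin θ) := by positivity
      have e : D θ = Real.cos θ ^ 2 + k' ^ 2 * Real.sin θ ^ 2 := by
        rw [Real.cos_sq', hk'2]; simp only [hD]; ring
      rw [e]
      nlinarith
    have hsp := Real.sqrt_pos.2 (hDpos θ)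
    refine mul_le_mul_of_nonneg_left ?_ hk0.le
    change 1 / Real.sqrt (D θ) ≤ _
    rw [div_le_div_iff₀ hsp (hDpos θ)]
    nth_rewrite 1 [← Real.mul_self_sqrt (hDpos θ).le]
    nlinarith
  have hval : G (Real.pi / 2) - G 0 = Real.log ((1 + k) / (1 - k)) / 2 + Real.arctan (k / k') := by
    simp only [hG]
    rw [Real.log_div (by linarith) (by linarith)]
    simp
  rw [hval] at hle
  have := (Real.arctan_lt_pi_div_two (k / k')).le
  linarith

lemma pi_div_two_le_ellipticK {k : ℝ} (hk : k ^ 2 < 1) : Real.pi / 2 ≤ ellipticK k := by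
  have hDpos : ∀ θ, 0 < 1 - k ^ 2 * Real.sin θ ^ 2 := by
    intro θ
    have := Real.sin_sq_le_one θ
    nlinarith [sq_nonneg k]
  have h : ∫ θ in (0 : ℝ)..(Real.pi / 2), (1 : ℝ) ≤ ellipticK k := by
    refine intervalIntegral.integral_mono_on (by positivity) (by simp)
      (Continuous.intervalIntegrable (Continuous.div (by fun_prop) (by fun_prop)
        fun θ => (Real.sqrt_pos.2 (hDpos θ)).ne') _ _) fun θ _ => ?_
    rw [le_div_iff₀ (Real.sqrt_pos.2 (hDpos θ)), one_mul]
    apply Real.sqrt_le_one.2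
    have : 0 ≤ k ^ 2 * Real.sin θ ^ 2 := by positivity
    linarith
  simpa using h

lemma decayRate_le {a b : ℝ} (ha : 0 < a) (hab : a < b) :
    a / b * decayRate a b ≤ Real.log ((b + a) / (b - a)) + Real.pi := by
  have hb : 0 < b := ha.trans hab
  have hk0 : 0 < a / b := by positivity
  have hk1 : a / b < 1 := (div_lt_one hb).2 hab
  have h1 := ellipticK_le hk0 hk1
  have h2 : Real.pi / 2 ≤ ellipticK (Real.sqrt (1 - (a / b) ^ 2)) := by
    apply pi_div_two_le_ellipticK
    rw [Real.sq_sqrt (by nlinarith)]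
    nlinarith
  have e : (1 + a / b) / (1 - a / b) = (b + a) / (b - a) := by
    have : b - a ≠ 0 := by linarith
    have : 1 - a / b ≠ 0 := by linarith
    field_simp
  rw [e] at h1
  have hpi := Real.pi_pos
  have h3 : a / b * decayRate a b = Real.pi * (a / b * ellipticK (a / b)) /
      ellipticK (Real.sqrt (1 - (a / b) ^ 2)) := by
    rw [decayRate]; ring
  have hK : 0 ≤ Real.log ((b + a) / (b - a)) / 2 + Real.pi / 2 := by
    have : 0 ≤ Real.log ((b + a) / (b - a)) := by
      apply Real.log_nonneg
      rw [le_div_iff₀ (by linarith)]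
      linarith
    positivity
  rw [h3, div_le_iff₀ (by linarith)]
  calc Real.pi * (a / b * ellipticK (a / b))
      ≤ Real.pi * (Real.log ((b + a) / (b - a)) / 2 + Real.pi / 2) := by gcongr
    _ = (Real.log ((b + a) / (b - a)) + Real.pi) * (Real.pi / 2) := by ring
    _ ≤ _ := by gcongr; linarith

/-- The open region bounded by an ellipse with foci `±1`. -/
def ellipseRegion (ω : ℝ) : Set ℂ := {s | ‖s - 1‖ + ‖s + 1‖ < ω}

lemma isOpen_ellipseRegion (ω : ℝ) : IsOpen (ellipseRegion ω) :=
  isOpen_lt (by fun_prop) continuous_const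

lemma neg_mem_ellipseRegion {ω : ℝ} {s : ℂ} (hs : s ∈ ellipseRegion ω) :
    -s ∈ ellipseRegion ω := by
  simp only [ellipseRegion, Set.mem_ofPred_eq] at hs ⊢
  rw [show -s - 1 = -(s + 1) by ring, show -s + 1 = -(s - 1) by ring, norm_neg, norm_neg,
    add_comm]
  exact hs

lemma ofReal_mem_ellipseRegion {ω x : ℝ} (hω : 2 < ω) (hx : |x| ≤ 1) :
    (x : ℂ) ∈ ellipseRegion ω := by
  obtain ⟨h1, h2⟩ := abs_le.1 hx
  simp only [ellipseRegion, Set.mem_ofPred_eq]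
  have e1 : ‖(x : ℂ) - 1‖ = 1 - x := by
    rw [← Complex.ofReal_one, ← Complex.ofReal_sub, Complex.norm_real, Real.norm_eq_abs,
      abs_of_nonpos (by linarith)]
    ring
  have e2 : ‖(x : ℂ) + 1‖ = 1 + x := by
    rw [← Complex.ofReal_one, ← Complex.ofReal_add, Complex.norm_real, Real.norm_eq_abs,
      abs_of_nonneg (by linarith)]
    ring
  rw [e1, e2]
  linarith

lemma two_mul_sq_sub_one_mem_ellipseRegion {ω : ℝ} {s : ℂ} (hs : s ∈ ellipseRegion ω) :
    2 * s ^ 2 - 1 ∈ ellipseRegion (ω ^ 2 - 2) := by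
  simp only [ellipseRegion, Set.mem_ofPred_eq] at hs ⊢
  have h := parallelogram_law_with_norm ℝ s 1
  rw [show 2 * s ^ 2 - 1 - 1 = 2 * ((s - 1) * (s + 1)) by ring,
    show 2 * s ^ 2 - 1 + 1 = 2 * (s * s) by ring]
  simp only [norm_mul, Complex.norm_ofNat, norm_one] at h ⊢
  have : 0 ≤ ‖s - 1‖ + ‖s + 1‖ := by positivity
  nlinarith

lemma two_mul_norm_lt_of_mem_ellipseRegion {ω : ℝ} {s : ℂ} (hs : s ∈ ellipseRegion ω) :
    2 * ‖s‖ < ω := by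
  refine lt_of_le_of_lt ?_ hs
  have := norm_add_le (s - 1) (s + 1)
  rw [show s - 1 + (s + 1) = 2 * s by ring, norm_mul] at this
  simpa using this

/-- A holomorphic map of an elliptic region into the right half-plane, symmetric about the real
axis, which carries the focal segment `[-1, 1]` onto `[a, b]`. -/
structure IsSlitMap (a b ω : ℝ) (φ : ℂ → ℂ) : Prop where
  differentiableOn : DifferentiableOn ℂ φ (ellipseRegion ω)
  re_pos : ∀ s ∈ ellipseRegion ω, 0 < (φ s).re
  im_eq_zero : ∀ s ∈ ellipseRegion ω, s.im = 0 → (φ s).im = 0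
  im_mul_pos : ∀ s ∈ ellipseRegion ω, s.im ≠ 0 → 0 < (φ s).im * s.im
  re_lt_re : ∀ x y : ℝ, (x : ℂ) ∈ ellipseRegion ω → (y : ℂ) ∈ ellipseRegion ω → x < y →
    (φ x).re < (φ y).re
  map_neg_one : φ (-1) = a
  map_one : φ 1 = b
  hasDerivAt_neg_one : ∃ d : ℝ, 0 < d ∧ HasDerivAt φ d (-1)
  hasDerivAt_one : ∃ d : ℝ, 0 < d ∧ HasDerivAt φ d 1

lemma isSlitMap_linear {a b ω : ℝ} (hab : a < b) (hω : ω ≤ 2 * ((b + a) / (b - a))) :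
    IsSlitMap a b ω fun s => ((a + b) / 2 : ℝ) + ((b - a) / 2 : ℝ) * s := by
  have hba : 0 < b - a := sub_pos.2 hab
  have hd : ∀ s : ℂ, HasDerivAt (fun s : ℂ => (((a + b) / 2 : ℝ) : ℂ) + ((b - a) / 2 : ℝ) * s)
      ((b - a) / 2 : ℝ) s := fun s => by
    simpa using ((hasDerivAt_id s).const_mul (((b - a) / 2 : ℝ) : ℂ)).const_add
      (((a + b) / 2 : ℝ) : ℂ)
  refine ⟨fun s _ => (hd s).differentiableAt.differentiableWithinAt, fun s hs => ?_,
    fun s _ h => ?_, fun s _ h => ?_, fun x y _ _ h => ?_, ?_, ?_, ⟨_, by linarith, hd _⟩,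
    ⟨_, by linarith, hd _⟩⟩
  · have h1 := two_mul_norm_lt_of_mem_ellipseRegion hs
    have h2 := (abs_le.1 (Complex.abs_re_le_norm s)).1
    have h3 : 2 * ‖s‖ < 2 * ((b + a) / (b - a)) := h1.trans_le hω
    have h4 : ‖s‖ * (b - a) < b + a := by
      rw [← lt_div_iff₀ hba]; linarith
    simp only [Complex.add_re, Complex.ofReal_re, Complex.re_ofReal_mul]
    nlinarith
  · simp [Complex.add_im, h]
  · simp only [Complex.add_im, Complex.ofReal_im, Complex.im_ofReal_mul]
    have : 0 < s.im ^ 2 := by positivity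
    nlinarith
  · simp only [Complex.add_re, Complex.ofReal_re, Complex.re_ofReal_mul]
    nlinarith
  · push_cast; ring
  · push_cast; ring

/-- The principal branch of the square root on the slit plane. -/
noncomputable def halfPow (z : ℂ) : ℂ := Complex.exp (Complex.log z / 2)

lemma halfPow_sq {z : ℂ} (hz : z ≠ 0) : halfPow z ^ 2 = z := by
  rw [halfPow, ← Complex.exp_nat_mul]
  push_cast
  rw [mul_div_cancel₀ _ (two_ne_zero), Complex.exp_log hz]

lemma halfPow_re_pos {z : ℂ} (hz : z ∈ Complex.slitPlane) : 0 < (halfPow z).re := by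
  rw [halfPow, Complex.exp_re]
  refine mul_pos (Real.exp_pos _) (Real.cos_pos_of_mem_Ioo ?_)
  have h1 := Complex.neg_pi_lt_arg z
  have h2 := lt_of_le_of_ne (Complex.arg_le_pi z) (Complex.mem_slitPlane_iff_arg.1 hz).1
  rw [show (Complex.log z / 2).im = z.arg / 2 by simp [Complex.log_im]]
  exact ⟨by linarith, by linarith⟩

lemma halfPow_im_of_pos {x : ℝ} (hx : 0 < x) : (halfPow x).im = 0 := by
  have h1 : (x : ℂ) ∈ Complex.slitPlane := Complex.ofReal_mem_slitPlane.2 hx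
  have h := congrArg Complex.im (halfPow_sq (Complex.slitPlane_ne_zero h1))
  rw [sq, Complex.mul_im, Complex.ofReal_im] at h
  have := halfPow_re_pos h1
  nlinarith

lemma DifferentiableOn.halfPow {f : ℂ → ℂ} {S : Set ℂ} (hf : DifferentiableOn ℂ f S)
    (hS : ∀ s ∈ S, f s ∈ Complex.slitPlane) : DifferentiableOn ℂ (fun s => halfPow (f s)) S :=
  ((hf.clog hS).div_const 2).cexp

lemma IsSlitMap.dslope_pos {a b ω : ℝ} {φ : ℂ → ℂ} (h : IsSlitMap a b ω φ) (hω : 2 < ω)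
    {x : ℝ} (hx : (x : ℂ) ∈ ellipseRegion ω) : ∃ d : ℝ, 0 < d ∧ dslope φ (-1) (x : ℂ) = d := by
  rcases eq_or_ne x (-1) with rfl | hne
  · obtain ⟨d, hd, hd'⟩ := h.hasDerivAt_neg_one
    refine ⟨d, hd, ?_⟩
    push_cast
    rw [dslope_same, hd'.deriv]
  · have hne' : (x : ℂ) ≠ -1 := by exact_mod_cast hne
    have hm1 : ((-1 : ℝ) : ℂ) ∈ ellipseRegion ω := ofReal_mem_ellipseRegion hω (by simp)
    have hre : φ x = ((φ x).re : ℂ) :=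
      Complex.ext (by simp) (by simp [h.im_eq_zero x hx (by simp)])
    have hre1 : (φ ((-1 : ℝ) : ℂ)).re = a := by push_cast; rw [h.map_neg_one]; simp
    refine ⟨((φ x).re - a) / (x + 1), ?_, ?_⟩
    · rcases lt_or_gt_of_ne hne with hlt | hlt
      · have := h.re_lt_re x (-1) hx hm1 hlt
        exact div_pos_of_neg_of_neg (by linarith) (by linarith)
      · have := h.re_lt_re (-1) x hm1 hx hlt
        exact div_pos (by linarith) (by linarith)
    · rw [dslope_of_ne _ hne', slope_def_field, hre, h.map_neg_one]
      push_cast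
      simp

lemma re_pos_of_mul_eq {p q : ℂ} {c : ℝ} (hc : 0 < c) (hpq : p * q = c) (h : 0 < (p + q).re) :
    0 < p.re := by
  have h1 := congrArg Complex.re hpq
  have h2 := congrArg Complex.im hpq
  simp only [Complex.mul_re, Complex.mul_im, Complex.ofReal_re, Complex.ofReal_im,
    Complex.add_re] at h1 h2 h
  have key : q.re * (p.re ^ 2 + p.im ^ 2) = c * p.re := by
    linear_combination p.re * h1 + p.im * h2
  by_contra hle
  have hq : 0 < q.re := by linarith
  have : 0 ≤ p.re ^ 2 + p.im ^ 2 := by positivity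
  have h3 : q.re * (p.re ^ 2 + p.im ^ 2) ≤ 0 := by rw [key]; nlinarith
  have h4 : p.re ^ 2 + p.im ^ 2 ≤ 0 := by
    by_contra h5
    have := mul_pos hq (not_le.1 h5)
    linarith
  have h5 : p.re = 0 := by nlinarith [sq_nonneg p.re, sq_nonneg p.im]
  have h6 : p.im = 0 := by nlinarith [sq_nonneg p.re, sq_nonneg p.im]
  rw [h5, h6] at h1
  linarith

/-- The expression whose square root is adjoined in the Landen step. -/
noncomputable def landenRadicand (φ : ℂ → ℂ) (g : ℝ) (s : ℂ) : ℂ :=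
  2 * dslope φ (-1) (2 * s ^ 2 - 1) * (φ (2 * s ^ 2 - 1) + g)

/-- The Landen step: solves `t + g² / t = 2 φ (2 s² - 1)` for `t`. -/
noncomputable def landenLift (φ : ℂ → ℂ) (g : ℝ) (s : ℂ) : ℂ :=
  φ (2 * s ^ 2 - 1) + s * halfPow (landenRadicand φ g s)

section Landen

variable {g m ω : ℝ} {φ : ℂ → ℂ}

lemma landenRadicand_neg (s : ℂ) : landenRadicand φ g (-s) = landenRadicand φ g s := by
  simp [landenRadicand]

lemma landenLift_add_neg (s : ℂ) :
    landenLift φ g s + landenLift φ g (-s) = 2 * φ (2 * s ^ 2 - 1) := by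
  simp only [landenLift, landenRadicand_neg, neg_sq]
  ring

lemma sq_mul_landenRadicand (h : IsSlitMap g m (ω ^ 2 - 2) φ) (s : ℂ) :
    s ^ 2 * landenRadicand φ g s = φ (2 * s ^ 2 - 1) ^ 2 - g ^ 2 := by
  have e := sub_smul_dslope φ (-1) (2 * s ^ 2 - 1)
  rw [h.map_neg_one, smul_eq_mul] at e
  rw [landenRadicand]
  linear_combination (φ (2 * s ^ 2 - 1) + g) * e

lemma landenRadicand_ofReal (h : IsSlitMap g m (ω ^ 2 - 2) φ) (hg : 0 < g) (hω : 2 < ω) {s : ℂ}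
    (hs : s ∈ ellipseRegion ω) (him : (2 * s ^ 2 - 1).im = 0) :
    ∃ r : ℝ, 0 < r ∧ landenRadicand φ g s = r := by
  have hs1 := two_mul_sq_sub_one_mem_ellipseRegion hs
  have hx : 2 * s ^ 2 - 1 = (((2 * s ^ 2 - 1).re : ℝ) : ℂ) :=
    Complex.ext (by simp) (by rw [him]; simp)
  obtain ⟨d, hd, hd'⟩ := h.dslope_pos (x := (2 * s ^ 2 - 1).re) (by nlinarith) (hx ▸ hs1)
  have hre : φ (2 * s ^ 2 - 1) = ((φ (2 * s ^ 2 - 1)).re : ℂ) :=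
    Complex.ext (by simp) (by simp [h.im_eq_zero _ hs1 him])
  rw [← hx] at hd'
  refine ⟨2 * d * ((φ (2 * s ^ 2 - 1)).re + g), ?_, ?_⟩
  · have := h.re_pos _ hs1
    positivity
  · rw [landenRadicand, hd', hre]
    push_cast
    simp

lemma im_two_mul_sq_sub_one (s : ℂ) : (2 * s ^ 2 - 1).im = 4 * (s.re * s.im) := by
  simp [sq, Complex.mul_im]
  ring

lemma landenRadicand_mem_slitPlane (h : IsSlitMap g m (ω ^ 2 - 2) φ) (hg : 0 < g) (hω : 2 < ω)
    {s : ℂ} (hs : s ∈ ellipseRegion ω) : landenRadicand φ g s ∈ Complex.slitPlane := by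
  by_cases him : (2 * s ^ 2 - 1).im = 0
  · obtain ⟨r, hr, e⟩ := landenRadicand_ofReal h hg hω hs him
    rw [e]
    exact Complex.ofReal_mem_slitPlane.2 hr
  · have hs1 := two_mul_sq_sub_one_mem_ellipseRegion hs
    have h1 := h.im_mul_pos _ hs1 him
    have h2 := h.re_pos _ hs1
    have e := congrArg Complex.im (sq_mul_landenRadicand h s)
    by_contra hcon
    rw [Complex.mem_slitPlane_iff, not_or, not_lt, not_not] at hcon
    rw [im_two_mul_sq_sub_one] at h1
    set Q := landenRadicand φ g s
    set t := φ (2 * s ^ 2 - 1)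
    rw [Complex.mul_im, hcon.2] at e
    simp only [sq, Complex.sub_im, Complex.mul_im, Complex.ofReal_im, Complex.mul_re,
      Complex.ofReal_re] at e
    have e' : 2 * (s.re * s.im) * Q.re = 2 * (t.re * t.im) := by linear_combination e
    have : 0 < t.re * (t.im * (4 * (s.re * s.im))) := by positivity
    have h3 : t.re * (t.im * (4 * (s.re * s.im))) = 4 * ((s.re * s.im) ^ 2 * Q.re) := by
      linear_combination -2 * (s.re * s.im) * e'
    have := mul_nonpos_of_nonneg_of_nonpos (sq_nonneg (s.re * s.im)) hcon.1
    linarith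

lemma landenLift_mul_neg (h : IsSlitMap g m (ω ^ 2 - 2) φ) (hg : 0 < g) (hω : 2 < ω)
    {s : ℂ} (hs : s ∈ ellipseRegion ω) :
    landenLift φ g s * landenLift φ g (-s) = ((g ^ 2 : ℝ) : ℂ) := by
  have e := sq_mul_landenRadicand h s
  have e2 := halfPow_sq (Complex.slitPlane_ne_zero (landenRadicand_mem_slitPlane h hg hω hs))
  simp only [landenLift, landenRadicand_neg, neg_sq]
  push_cast
  linear_combination -s ^ 2 * e2 - e

lemma differentiableOn_landenLift (h : IsSlitMap g m (ω ^ 2 - 2) φ) (hg : 0 < g) (hω : 2 < ω) :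
    DifferentiableOn ℂ (landenLift φ g) (ellipseRegion ω) := by
  have hpoly : DifferentiableOn ℂ (fun s : ℂ => 2 * s ^ 2 - 1) (ellipseRegion ω) := by fun_prop
  have hmaps : Set.MapsTo (fun s : ℂ => 2 * s ^ 2 - 1) (ellipseRegion ω)
      (ellipseRegion (ω ^ 2 - 2)) := fun s hs => two_mul_sq_sub_one_mem_ellipseRegion hs
  have h1 : DifferentiableOn ℂ (fun s : ℂ => φ (2 * s ^ 2 - 1)) (ellipseRegion ω) :=
    h.differentiableOn.comp hpoly hmaps
  have hm1 : (-1 : ℂ) ∈ ellipseRegion (ω ^ 2 - 2) := by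
    simpa using ofReal_mem_ellipseRegion (ω := ω ^ 2 - 2) (x := -1) (by nlinarith) (by simp)
  have h2 : DifferentiableOn ℂ (fun s : ℂ => dslope φ (-1) (2 * s ^ 2 - 1)) (ellipseRegion ω) :=
    ((Complex.differentiableOn_dslope ((isOpen_ellipseRegion _).mem_nhds hm1)).2
      h.differentiableOn).comp hpoly hmaps
  have h3 : DifferentiableOn ℂ (landenRadicand φ g) (ellipseRegion ω) :=
    (h2.const_mul 2).mul (h1.add_const _)
  exact h1.add (differentiableOn_id.mul
    (h3.halfPow fun s hs => landenRadicand_mem_slitPlane h hg hω hs))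

lemma landenLift_re_pos (h : IsSlitMap g m (ω ^ 2 - 2) φ) (hg : 0 < g) (hω : 2 < ω)
    {s : ℂ} (hs : s ∈ ellipseRegion ω) : 0 < (landenLift φ g s).re := by
  refine re_pos_of_mul_eq (by positivity) (landenLift_mul_neg h hg hω hs) ?_
  rw [landenLift_add_neg]
  have := h.re_pos _ (two_mul_sq_sub_one_mem_ellipseRegion hs)
  simpa using this

lemma landenLift_im_eq_zero (h : IsSlitMap g m (ω ^ 2 - 2) φ) (hg : 0 < g) (hω : 2 < ω)
    {s : ℂ} (hs : s ∈ ellipseRegion ω) (him : s.im = 0) : (landenLift φ g s).im = 0 := by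
  have h1 : (2 * s ^ 2 - 1).im = 0 := by rw [im_two_mul_sq_sub_one, him]; ring
  obtain ⟨r, hr, e⟩ := landenRadicand_ofReal h hg hω hs h1
  rw [landenLift, e, Complex.add_im, Complex.mul_im, halfPow_im_of_pos hr, him,
    h.im_eq_zero _ (two_mul_sq_sub_one_mem_ellipseRegion hs) h1]
  ring

lemma landenLift_im_mul_pos_of_re_pos (h : IsSlitMap g m (ω ^ 2 - 2) φ) (hg : 0 < g) (hω : 2 < ω)
    {s : ℂ} (hs : s ∈ ellipseRegion ω) (him : s.im ≠ 0) (hre : 0 < s.re) :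
    0 < (landenLift φ g s).im * s.im := by
  have hs1 := two_mul_sq_sub_one_mem_ellipseRegion hs
  have him1 : (2 * s ^ 2 - 1).im ≠ 0 := by
    rw [im_two_mul_sq_sub_one]
    have := hre.ne'
    positivity
  have h1 := h.im_mul_pos _ hs1 him1
  have h2 := h.re_pos _ hs1
  have hQ := landenRadicand_mem_slitPlane h hg hω hs
  have hr := halfPow_re_pos hQ
  have e := congrArg Complex.im (sq_mul_landenRadicand h s)
  rw [← halfPow_sq (Complex.slitPlane_ne_zero hQ), ← mul_pow] at e
  rw [im_two_mul_sq_sub_one] at h1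
  rw [landenLift, Complex.add_im]
  set r := halfPow (landenRadicand φ g s)
  set t := φ (2 * s ^ 2 - 1)
  have hu : (s * r).re * s.re + (s * r).im * s.im = r.re * (s.re ^ 2 + s.im ^ 2) := by
    simp only [Complex.mul_re, Complex.mul_im]
    ring
  set u := s * r
  simp only [sq u, sq t, sq (g : ℂ), Complex.sub_im, Complex.mul_im, Complex.ofReal_im,
    Complex.ofReal_re] at e
  have e' : u.re * u.im = t.re * t.im := by linarith
  have htim : 0 < t.im * s.im := by
    have : 0 < (4 * s.re) * (t.im * s.im) := by linarith
    exact (mul_pos_iff_of_pos_left (by positivity)).1 this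
  have hu1 : 0 < u.re * (u.im * s.im) := by
    have : u.re * (u.im * s.im) = t.re * (t.im * s.im) := by linear_combination s.im * e'
    rw [this]
    positivity
  have hu2 : 0 < u.re * s.re + u.im * s.im := by
    rw [hu]
    have := sq_pos_of_pos hre
    positivity
  have hu3 : 0 < u.im * s.im := by
    by_contra hcon
    have h3 : u.re < 0 := by
      by_contra h4
      nlinarith [mul_nonneg (not_lt.1 h4) (neg_nonneg.2 (not_lt.1 hcon))]
    nlinarith
  linarith

lemma landenLift_im_mul_pos (h : IsSlitMap g m (ω ^ 2 - 2) φ) (hg : 0 < g) (hω : 2 < ω)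
    {s : ℂ} (hs : s ∈ ellipseRegion ω) (him : s.im ≠ 0) : 0 < (landenLift φ g s).im * s.im := by
  rcases lt_trichotomy s.re 0 with hre | hre | hre
  · have hns := neg_mem_ellipseRegion hs
    have h1 := landenLift_im_mul_pos_of_re_pos h hg hω hns (by simpa using him)
      (by simpa using hre)
    have hp := landenLift_re_pos h hg hω hs
    have hq := landenLift_re_pos h hg hω hns
    have e := congrArg Complex.im (landenLift_mul_neg h hg hω hs)
    rw [Complex.mul_im, Complex.ofReal_im] at e
    rw [Complex.neg_im] at h1
    set p := landenLift φ g s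
    set q := landenLift φ g (-s)
    have : q.re * (p.im * s.im) = p.re * (q.im * -s.im) := by linear_combination s.im * e
    have : 0 < q.re * (p.im * s.im) := by rw [this]; positivity
    exact (mul_pos_iff_of_pos_left hq).1 this
  · have h1 : (2 * s ^ 2 - 1).im = 0 := by rw [im_two_mul_sq_sub_one, hre]; ring
    obtain ⟨r, hr, e⟩ := landenRadicand_ofReal h hg hω hs h1
    have hpos := halfPow_re_pos (Complex.ofReal_mem_slitPlane.2 hr)
    rw [landenLift, e, Complex.add_im, Complex.mul_im, halfPow_im_of_pos hr, hre,
      h.im_eq_zero _ (two_mul_sq_sub_one_mem_ellipseRegion hs) h1]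
    have : 0 < s.im ^ 2 := by positivity
    nlinarith
  · exact landenLift_im_mul_pos_of_re_pos h hg hω hs him hre

lemma exists_landenLift_ofReal (h : IsSlitMap g m (ω ^ 2 - 2) φ) (hg : 0 < g) (hω : 2 < ω)
    {x : ℝ} (hx : (x : ℂ) ∈ ellipseRegion ω) :
    ∃ r : ℝ, 0 < r ∧ (landenLift φ g x).re = (φ ((2 * x ^ 2 - 1 : ℝ) : ℂ)).re + x * r ∧
      (x * r) ^ 2 = (φ ((2 * x ^ 2 - 1 : ℝ) : ℂ)).re ^ 2 - g ^ 2 := by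
  have h1 : (2 * (x : ℂ) ^ 2 - 1).im = 0 := by rw [im_two_mul_sq_sub_one]; simp
  obtain ⟨r, hr, e⟩ := landenRadicand_ofReal h hg hω hx h1
  have hpos := halfPow_re_pos (Complex.ofReal_mem_slitPlane.2 hr)
  have him := halfPow_im_of_pos hr
  have e2 := congrArg Complex.re (sq_mul_landenRadicand h (x : ℂ))
  have e3 := congrArg Complex.re (halfPow_sq (Complex.ofReal_ne_zero.2 hr.ne'))
  have him' := h.im_eq_zero _ (two_mul_sq_sub_one_mem_ellipseRegion hx) h1
  rw [e] at e2
  refine ⟨_, hpos, ?_, ?_⟩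
  · rw [landenLift, e]
    push_cast
    simp
  · push_cast
    simp only [sq, Complex.mul_re, Complex.mul_im, Complex.ofReal_re, Complex.ofReal_im,
      Complex.sub_re, him] at e2 e3 him' ⊢
    rw [him'] at e2
    linear_combination e2 + x ^ 2 * e3

lemma landenLift_re_lt_re (h : IsSlitMap g m (ω ^ 2 - 2) φ) (hg : 0 < g) (hω : 2 < ω) (x y : ℝ)
    (hx : (x : ℂ) ∈ ellipseRegion ω) (hy : (y : ℂ) ∈ ellipseRegion ω) (hxy : x < y) :
    (landenLift φ g x).re < (landenLift φ g y).re := by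
  have hpos : ∀ x y : ℝ, (x : ℂ) ∈ ellipseRegion ω → (y : ℂ) ∈ ellipseRegion ω → 0 ≤ x →
      x < y → (landenLift φ g x).re < (landenLift φ g y).re := by
    intro x y hx hy h0 hxy
    obtain ⟨r, hr, e1, e2⟩ := exists_landenLift_ofReal h hg hω hx
    obtain ⟨r', hr', e1', e2'⟩ := exists_landenLift_ofReal h hg hω hy
    have hx1 := two_mul_sq_sub_one_mem_ellipseRegion hx
    have hy1 := two_mul_sq_sub_one_mem_ellipseRegion hy
    have hlt := h.re_lt_re (2 * x ^ 2 - 1) (2 * y ^ 2 - 1) (by push_cast; exact hx1)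
      (by push_cast; exact hy1) (by nlinarith)
    have hp := h.re_pos _ hx1
    rw [e1, e1']
    have hp' : 0 < (φ ((2 * x ^ 2 - 1 : ℝ) : ℂ)).re := by push_cast; exact hp
    have : x * r ≤ y * r' := by
      apply le_of_sq_le_sq _ (by have := h0.trans_lt hxy; positivity)
      rw [e2, e2']
      nlinarith
    linarith
  have hmul : ∀ x : ℝ, (x : ℂ) ∈ ellipseRegion ω →
      (landenLift φ g x).re * (landenLift φ g ((-x : ℝ) : ℂ)).re = g ^ 2 := by
    intro x hx
    have e := congrArg Complex.re (landenLift_mul_neg h hg hω hx)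
    rw [Complex.mul_re, landenLift_im_eq_zero h hg hω hx (by simp)] at e
    push_cast
    simpa [← Complex.ofReal_pow] using e
  have hneg : ∀ x y : ℝ, (x : ℂ) ∈ ellipseRegion ω → (y : ℂ) ∈ ellipseRegion ω → y ≤ 0 →
      x < y → (landenLift φ g x).re < (landenLift φ g y).re := by
    intro x y hx hy h0 hxy
    have hx' : ((-x : ℝ) : ℂ) ∈ ellipseRegion ω := by push_cast; exact neg_mem_ellipseRegion hx
    have hy' : ((-y : ℝ) : ℂ) ∈ ellipseRegion ω := by push_cast; exact neg_mem_ellipseRegion hy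
    have hlt := hpos (-y) (-x) hy' hx' (by linarith) (by linarith)
    have h1 := hmul x hx
    have h2 := hmul y hy
    have h3 := landenLift_re_pos h hg hω hy'
    have h4 := landenLift_re_pos h hg hω hx
    by_contra hcon
    nlinarith
  have h0 : ((0 : ℝ) : ℂ) ∈ ellipseRegion ω := ofReal_mem_ellipseRegion hω (by simp)
  rcases le_or_gt 0 x with hx0 | hx0
  · exact hpos x y hx hy hx0 hxy
  · rcases le_or_gt y 0 with hy0 | hy0
    · exact hneg x y hx hy hy0 hxy
    · exact (hneg x 0 hx h0 le_rfl hx0).trans (hpos 0 y h0 hy le_rfl hy0)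

end Landen

lemma IsSlitMap.landenLift {a b ω : ℝ} {φ : ℂ → ℂ} (ha : 0 < a) (hab : a < b) (hω : 2 < ω)
    (h : IsSlitMap (Real.sqrt (a * b)) ((a + b) / 2) (ω ^ 2 - 2) φ) :
    IsSlitMap a b ω (landenLift φ (Real.sqrt (a * b))) := by
  have hb : 0 < b := ha.trans hab
  have hg : 0 < Real.sqrt (a * b) := by positivity
  have hg2 : Real.sqrt (a * b) ^ 2 = a * b := Real.sq_sqrt (by positivity)
  set g := Real.sqrt (a * b)
  have h1 : ((1 : ℝ) : ℂ) ∈ ellipseRegion ω := ofReal_mem_ellipseRegion hω (by simp)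
  have hdiff := differentiableOn_landenLift h hg hω
  have hmap1 : _root_.landenLift φ g 1 = b := by
    obtain ⟨r, hr, e1, e2⟩ := exists_landenLift_ofReal h hg hω h1
    rw [show 2 * (1 : ℝ) ^ 2 - 1 = 1 by norm_num, Complex.ofReal_one, h.map_one,
      Complex.ofReal_re] at e1 e2
    rw [hg2, one_mul] at e2
    have : r = (b - a) / 2 := by
      apply (sq_eq_sq₀ hr.le (by linarith)).1
      rw [e2]; ring
    apply Complex.ext
    · rw [e1, this, Complex.ofReal_re]; ring
    · simpa using landenLift_im_eq_zero h hg hω h1 (by simp)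
  have hmapm1 : _root_.landenLift φ g (-1) = a := by
    have e := landenLift_mul_neg h hg hω h1
    rw [Complex.ofReal_one, hmap1, hg2, Complex.ofReal_mul, mul_comm] at e
    exact mul_right_cancel₀ (Complex.ofReal_ne_zero.2 hb.ne') e
  have hU := isOpen_ellipseRegion ω
  have h1' : (1 : ℂ) ∈ ellipseRegion ω := by simpa using h1
  have hp := (hdiff.differentiableAt (hU.mem_nhds h1')).hasDerivAt
  have hq := (hdiff.differentiableAt (hU.mem_nhds (neg_mem_ellipseRegion h1'))).hasDerivAt
  set p := deriv (_root_.landenLift φ g) 1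
  set q := deriv (_root_.landenLift φ g) (-1)
  have hqneg : HasDerivAt (fun s => _root_.landenLift φ g (-s)) (-q) 1 := by
    have := hq.comp (1 : ℂ) (hasDerivAt_neg (1 : ℂ))
    rw [mul_neg_one] at this
    exact this
  obtain ⟨d, hd, hd'⟩ := h.hasDerivAt_one
  have e1 : p + -q = 8 * d := by
    have h2 := hp.add hqneg
    have hs1 : HasDerivAt (fun s : ℂ => 2 * s ^ 2 - 1) 4 1 := by
      have := (((hasDerivAt_id (1 : ℂ)).pow 2).const_mul 2).sub_const 1
      refine this.congr_deriv ?_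
      norm_num
    have h3 : HasDerivAt (fun s : ℂ => 2 * φ (2 * s ^ 2 - 1)) (2 * (d * 4)) 1 := by
      refine HasDerivAt.const_mul _ (HasDerivAt.comp (1 : ℂ) ?_ hs1)
      rw [show 2 * (1 : ℂ) ^ 2 - 1 = 1 by norm_num]
      exact hd'
    have h4 : (fun s : ℂ => 2 * φ (2 * s ^ 2 - 1)) =
        _root_.landenLift φ g + fun s => _root_.landenLift φ g (-s) :=
      funext fun s => (landenLift_add_neg s).symm
    rw [h4] at h3
    rw [h2.unique h3]
    ring
  have e2 : p * a + b * -q = 0 := by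
    have h2 := hp.mul hqneg
    have h3 : HasDerivAt (_root_.landenLift φ g * fun s => _root_.landenLift φ g (-s)) 0 1 := by
      refine (hasDerivAt_const (1 : ℂ) ((g ^ 2 : ℝ) : ℂ)).congr_of_eventuallyEq ?_
      filter_upwards [hU.mem_nhds h1'] with s hs
      exact landenLift_mul_neg h hg hω hs
    have := h2.unique h3
    rwa [hmap1, hmapm1] at this
  have hba : (b : ℂ) - a ≠ 0 := by exact_mod_cast (sub_pos.2 hab).ne'
  refine ⟨hdiff, fun s hs => landenLift_re_pos h hg hω hs,
    fun s hs => landenLift_im_eq_zero h hg hω hs, fun s hs => landenLift_im_mul_pos h hg hω hs,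
    landenLift_re_lt_re h hg hω, hmapm1, hmap1,
    ⟨8 * d * a / (b - a), ?_, ?_⟩, ⟨8 * d * b / (b - a), ?_, ?_⟩⟩
  · have := sub_pos.2 hab
    positivity
  · refine hq.congr_deriv (Eq.symm ?_)
    push_cast
    rw [div_eq_iff hba]
    linear_combination -a * e1 + e2
  · have := sub_pos.2 hab
    positivity
  · refine hp.congr_deriv (Eq.symm ?_)
    push_cast
    rw [div_eq_iff hba]
    linear_combination -b * e1 + e2

/-- Slit maps exist on every elliptic region below the critical size given by the ratio of
complete elliptic integrals. -/
theorem exists_isSlitMap {a b h : ℝ} (ha : 0 < a) (hab : a < b) (hh : 0 < h)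
    (hlt : h < decayRate a b) : ∃ φ, IsSlitMap a b (2 * Real.cosh h) φ := by
  have key : ∀ (N : ℕ) (a b h : ℝ), 0 < a → a < b → 0 < h →
      2 ^ N * h ≤ (2 ^ N - Real.log (b / a)) * decayRate a b - Real.pi →
      ∃ φ, IsSlitMap a b (2 * Real.cosh h) φ := by
    intro N
    induction N with
    | zero =>
      intro a b h ha hab hh hle
      have hb := ha.trans hab
      refine ⟨_, isSlitMap_linear hab ?_⟩
      have h1 := decayRate_le ha hab
      have h2 := decayRate_pos ha hab
      have h3 : 1 - Real.log (b / a) ≤ a / b := by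
        have := Real.add_one_le_exp (-Real.log (b / a))
        rw [Real.exp_neg, Real.exp_log (by positivity), inv_div] at this
        linarith
      have h4 : h ≤ Real.log ((b + a) / (b - a)) := by
        have := mul_le_mul_of_nonneg_right h3 h2.le
        simp only [pow_zero, one_mul] at hle
        linarith
      have hba := sub_pos.2 hab
      have h5 : Real.exp h ≤ (b + a) / (b - a) :=
        (Real.le_log_iff_exp_le (by positivity)).1 h4
      have h6 : Real.cosh h ≤ Real.exp h := by
        rw [Real.cosh_eq]
        have := Real.exp_le_exp.2 (show -h ≤ h by linarith)
        linarith
      linarith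
    | succ N ih =>
      intro a b h ha hab hh hle
      have hb := ha.trans hab
      have hg : 0 < Real.sqrt (a * b) := by positivity
      have hlt := sqrt_mul_lt_mean ha hab
      have hH := decayRate_pos ha hab
      obtain ⟨φ, hφ⟩ := ih (Real.sqrt (a * b)) ((a + b) / 2) (2 * h) hg hlt (by linarith) (by
        rw [decayRate_agm ha hab]
        have hlog : 2 * Real.log ((a + b) / 2 / Real.sqrt (a * b)) ≤ Real.log (b / a) := by
          have : 2 * Real.log ((a + b) / 2 / Real.sqrt (a * b)) =
              Real.log (((a + b) / 2 / Real.sqrt (a * b)) ^ 2) := by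
            rw [Real.log_pow]; norm_num
          rw [this]
          apply Real.log_le_log (by positivity)
          rw [div_pow, Real.sq_sqrt (by positivity), div_le_div_iff₀ (by positivity) ha]
          have : (a + b) ^ 2 ≤ 4 * b ^ 2 := by nlinarith
          nlinarith
        have := mul_le_mul_of_nonneg_right hlog hH.le
        rw [pow_succ] at hle
        nlinarith)
      refine ⟨_, IsSlitMap.landenLift ha hab ?_ (φ := φ) ?_⟩
      · have := Real.one_lt_cosh.2 hh.ne'
        linarith
      · convert hφ using 1
        rw [Real.cosh_two_mul, Real.sinh_sq]
        ring
  obtain ⟨N, hN⟩ := pow_unbounded_of_one_lt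
    ((Real.log (b / a) * decayRate a b + Real.pi) / (decayRate a b - h)) (one_lt_two)
  refine key N a b h ha hab hh ?_
  rw [div_lt_iff₀ (by linarith)] at hN
  linarith

open MeasureTheory AddCircle in
lemma Continuous.integrable_haarAddCircle {T : ℝ} [Fact (0 < T)] {E : Type*}
    [NormedAddCommGroup E] {f : AddCircle T → E} (hf : Continuous f) :
    Integrable f haarAddCircle :=
  hf.integrable_of_hasCompactSupport (HasCompactSupport.of_compactSpace f)

open MeasureTheory AddCircle in
lemma fourierCoeff_of_hasSum {T : ℝ} [Fact (0 < T)] {u : ℤ → ℂ} (hu : Summable fun k => ‖u k‖)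
    {U : AddCircle T → ℂ} (hU : ∀ x, HasSum (fun k => u k * fourier k x) (U x)) (n : ℤ) :
    fourierCoeff U n = u n := by
  have h := hasSum_integral_of_summable_integral_norm (μ := haarAddCircle (T := T))
    (F := fun (k : ℤ) (x : AddCircle T) => fourier (-n) x • (u k * fourier k x))
    (fun k => Continuous.integrable_haarAddCircle ((map_continuous (fourier (-n))).smul
      (continuous_const.mul (map_continuous (fourier k))))) (by
      simp only [norm_smul, norm_mul, Circle.norm_coe, fourier_apply, one_mul, mul_one]
      simpa using hu)
  have h1 : ∀ k : ℤ, ∫ x, fourier (-n) x • (u k * fourier k x) ∂haarAddCircle (T := T) =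
      if k = n then u n else 0 := by
    intro k
    have h2 := congrFun (fourierCoeff_fourier (T := T) k) n
    rw [fourierCoeff] at h2
    have h3 : ∀ x : AddCircle T, fourier (-n) x • (u k * fourier k x) =
        u k * (fourier (-n) x • fourier k x) := fun x => by simp only [smul_eq_mul]; ring
    simp only [h3, integral_const_mul, h2, Pi.single_apply]
    by_cases hk : k = n
    · simp [hk]
    · simp [hk, Ne.symm hk]
  simp only [h1] at h
  have h2 : ∫ x, ∑' k, fourier (-n) x • (u k * fourier k x) ∂haarAddCircle (T := T) =
      fourierCoeff U n := by
    rw [fourierCoeff]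
    congr 1
    ext x
    exact ((hU x).const_smul (fourier (-n) x)).tsum_eq
  rw [h2] at h
  exact h.unique (hasSum_ite_eq n (u n))

lemma hasSum_poissonKernel {r : ℝ} (hr0 : 0 ≤ r) (hr1 : r < 1) {z : ℂ} (hz : ‖z‖ = 1) :
    HasSum (fun k : ℤ => ((r ^ k.natAbs : ℝ) : ℂ) * z ^ k)
      (((1 - r ^ 2) / Complex.normSq (1 - r * z) : ℝ) : ℂ) := by
  have hz0 : z ≠ 0 := by rintro rfl; simp at hz
  have hinv : z⁻¹ = (starRingEnd ℂ) z := Complex.inv_eq_conj hz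
  have hn : ‖(r : ℂ) * z‖ < 1 := by
    rw [norm_mul, hz, Complex.norm_real, Real.norm_eq_abs, abs_of_nonneg hr0]; linarith
  have hn' : ‖(r : ℂ) * z⁻¹‖ < 1 := by
    rw [norm_mul, norm_inv, hz, Complex.norm_real, Real.norm_eq_abs, abs_of_nonneg hr0]
    simpa using hr1
  have h1 := hasSum_geometric_of_norm_lt_one hn
  have h2 := (hasSum_geometric_of_norm_lt_one hn').mul_left ((r : ℂ) * z⁻¹)
  have hne : 1 - (r : ℂ) * z ≠ 0 := by
    intro h
    rw [← sub_eq_zero.1 h] at hn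
    simp at hn
  have hne' : 1 - (r : ℂ) * z⁻¹ ≠ 0 := by
    intro h
    rw [← sub_eq_zero.1 h] at hn'
    simp at hn'
  have hsq : (Complex.normSq (1 - r * z) : ℂ) = (1 - r * z) * (1 - r * z⁻¹) := by
    rw [← Complex.mul_conj, hinv]
    simp
  have h := HasSum.of_nat_of_neg_add_one (f := fun k : ℤ => ((r ^ k.natAbs : ℝ) : ℂ) * z ^ k)
    (m := (1 - (r : ℂ) * z)⁻¹) (m' := (r : ℂ) * z⁻¹ * (1 - (r : ℂ) * z⁻¹)⁻¹) (by
      simpa [mul_pow] using h1) (by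
      refine h2.congr_fun fun n => ?_
      have : (-((n : ℤ) + 1)).natAbs = n + 1 := by omega
      rw [this, zpow_neg, ← Nat.cast_succ, zpow_natCast, Nat.succ_eq_add_one]
      push_cast
      rw [mul_pow, inv_pow, pow_succ, pow_succ, mul_inv]
      ring)
  convert h using 1
  rw [Complex.ofReal_div, hsq]
  have hzw : z * z⁻¹ = 1 := mul_inv_cancel₀ hz0
  set w := z⁻¹
  rw [div_eq_iff (mul_ne_zero hne hne'), add_mul]
  rw [show (1 - (r : ℂ) * z)⁻¹ * ((1 - r * z) * (1 - r * w)) = 1 - r * w by field_simp,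
    show (r : ℂ) * w * (1 - r * w)⁻¹ * ((1 - r * z) * (1 - r * w)) = r * w * (1 - r * z) by
      field_simp]
  push_cast
  linear_combination (r : ℂ) ^ 2 * hzw

open MeasureTheory AddCircle in
/-- Averaging against the Poisson kernel does not increase the supremum norm of an absolutely
convergent Laurent series on the unit circle. -/
lemma norm_tsum_pow_natAbs_mul_le {u : ℤ → ℂ} (hu : Summable fun k => ‖u k‖) {B : ℝ}
    (hB : ∀ z : ℂ, ‖z‖ = 1 → ‖∑' k, u k * z ^ k‖ ≤ B) {r : ℝ} (hr0 : 0 ≤ r) (hr1 : r < 1) :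
    ‖∑' k : ℤ, ((r ^ k.natAbs : ℝ) : ℂ) * u k‖ ≤ B := by
  set P : UnitAddCircle → ℝ := fun x => (1 - r ^ 2) / Complex.normSq (1 - r * (toCircle x : ℂ))
    with hP
  have hfourier : ∀ (k : ℤ) (x : UnitAddCircle), fourier k x = (toCircle x : ℂ) ^ k := by
    intro k x
    rw [fourier_apply, toCircle_zsmul, Circle.coe_zpow]
  have hPsum : ∀ x, HasSum (fun k : ℤ => ((r ^ k.natAbs : ℝ) : ℂ) * fourier k x) (P x : ℂ) := by
    intro x
    simp only [hfourier]
    exact hasSum_poissonKernel hr0 hr1 (Circle.norm_coe _)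
  have hden : ∀ x : UnitAddCircle, 0 < Complex.normSq (1 - r * (toCircle x : ℂ)) := by
    intro x
    rw [Complex.normSq_pos]
    intro h
    have h2 := congrArg norm (sub_eq_zero.1 h)
    rw [norm_mul, Circle.norm_coe, Complex.norm_real, Real.norm_eq_abs, abs_of_nonneg hr0] at h2
    simp at h2
    linarith
  have hPcont : Continuous P :=
    continuous_const.div (Complex.continuous_normSq.comp
      (continuous_const.sub (continuous_const.mul
        (continuous_subtype_val.comp continuous_toCircle)))) fun x => (hden x).ne'
  have hPnn : ∀ x, 0 ≤ P x := fun x => div_nonneg (by nlinarith) (hden x).le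
  have hrsum : Summable fun k : ℤ => ‖((r ^ k.natAbs : ℝ) : ℂ)‖ := by
    have := (hPsum 0).summable.norm
    simpa [norm_mul] using this
  have hPcoeff : ∀ n : ℤ, fourierCoeff (fun x => (P x : ℂ)) n = ((r ^ n.natAbs : ℝ) : ℂ) :=
    fun n => fourierCoeff_of_hasSum hrsum hPsum n
  obtain ⟨C, hC⟩ : ∃ C, ∀ x, ‖P x‖ ≤ C := by
    obtain ⟨C, hC⟩ := isCompact_univ.exists_bound_of_continuousOn hPcont.continuousOn
    exact ⟨C, fun x => hC x (Set.mem_univ x)⟩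
  have hPC : Continuous fun x => (P x : ℂ) := Complex.continuous_ofReal.comp hPcont
  have hterm : ∀ k : ℤ, Continuous fun x : UnitAddCircle => (P x : ℂ) * (u k * fourier k x) :=
    fun k => hPC.mul (continuous_const.mul (map_continuous (fourier k)))
  have h := hasSum_integral_of_summable_integral_norm (μ := haarAddCircle (T := 1))
    (F := fun (k : ℤ) (x : UnitAddCircle) => (P x : ℂ) * (u k * fourier k x))
    (fun k => (hterm k).integrable_haarAddCircle) (by
      refine Summable.of_nonneg_of_le (fun k => integral_nonneg fun x => norm_nonneg _)
        (fun k => ?_) (hu.mul_left C)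
      have h1 : ∫ x, ‖(P x : ℂ) * (u k * fourier k x)‖ ∂haarAddCircle (T := 1) ≤
          ∫ x, C * ‖u k‖ ∂haarAddCircle (T := 1) := by
        refine integral_mono (hterm k).integrable_haarAddCircle.norm (integrable_const _) fun x => ?_
        simp only [norm_mul, Complex.norm_real, fourier_apply, Circle.norm_coe, mul_one]
        exact mul_le_mul_of_nonneg_right (hC x) (norm_nonneg _)
      simpa using h1)
  have h1 : ∀ k : ℤ, ∫ x, (P x : ℂ) * (u k * fourier k x) ∂haarAddCircle (T := 1) =
      ((r ^ k.natAbs : ℝ) : ℂ) * u k := by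
    intro k
    have h2 := hPcoeff (-k)
    rw [fourierCoeff, Int.natAbs_neg, neg_neg] at h2
    rw [← h2, mul_comm, ← integral_const_mul]
    congr 1
    ext x
    rw [smul_eq_mul]
    ring
  simp only [h1] at h
  rw [h.tsum_eq]
  have hP1 : ∫ x, P x ∂haarAddCircle (T := 1) = 1 := by
    have h2 := hPcoeff 0
    simp only [fourierCoeff, neg_zero, smul_eq_mul, Int.natAbs_zero, pow_zero] at h2
    have h3 : ∀ x : UnitAddCircle, fourier 0 x * (P x : ℂ) = (P x : ℂ) := fun x => by simp
    simp only [h3] at h2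
    rw [integral_complex_ofReal] at h2
    exact_mod_cast h2
  calc ‖∫ x, ∑' k : ℤ, (P x : ℂ) * (u k * fourier k x) ∂haarAddCircle (T := 1)‖
      ≤ ∫ x, P x * B ∂haarAddCircle (T := 1) := by
        refine norm_integral_le_of_norm_le (Integrable.mul_const ?_ B)
          (Filter.Eventually.of_forall fun x => ?_)
        · exact hPcont.integrable_haarAddCircle
        · rw [tsum_mul_left, norm_mul, Complex.norm_real, Real.norm_eq_abs, abs_of_nonneg (hPnn x)]
          refine mul_le_mul_of_nonneg_left ?_ (hPnn x)
          simp only [hfourier]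
          exact hB _ (Circle.norm_coe _)
    _ = B := by rw [integral_mul_const, hP1, one_mul]

/-- The shifted form of `norm_tsum_pow_natAbs_mul_le`. -/
lemma norm_tsum_pow_natAbs_sub_mul_le {u : ℤ → ℂ} (hu : Summable fun k => ‖u k‖) {B : ℝ}
    (hB : ∀ z : ℂ, ‖z‖ = 1 → ‖∑' k, u k * z ^ k‖ ≤ B) {r : ℝ} (hr0 : 0 ≤ r) (hr1 : r < 1) (n : ℤ)
    {z : ℂ} (hz : ‖z‖ = 1) :
    ‖∑' k : ℤ, ((r ^ (k - n).natAbs : ℝ) : ℂ) * (u k * z ^ k)‖ ≤ B := by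
  have hz0 : z ≠ 0 := by rintro rfl; simp at hz
  have hv : Summable fun k => ‖u (k + n) * z ^ (k + n)‖ := by
    simp only [norm_mul, norm_zpow, hz, one_zpow, mul_one]
    exact (Equiv.addRight n).summable_iff.2 hu
  have h := norm_tsum_pow_natAbs_mul_le hv (B := B) (fun w hw => ?_) hr0 hr1
  · convert h using 2
    rw [← (Equiv.addRight n).tsum_eq]
    simp
  · have hw0 : w ≠ 0 := by rintro rfl; simp at hw
    have h1 := hB (z * w) (by rw [norm_mul, hz, hw, one_mul])
    rw [← (Equiv.addRight n).tsum_eq] at h1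
    have e : ∀ k : ℤ, u (Equiv.addRight n k) * (z * w) ^ (Equiv.addRight n k) =
        w ^ n * (u (k + n) * z ^ (k + n) * w ^ k) := by
      intro k
      simp only [Equiv.coe_addRight, mul_zpow]
      rw [zpow_add₀ hw0]
      ring
    simp only [e, tsum_mul_left, norm_mul, norm_zpow, hw, one_zpow, one_mul] at h1
    exact h1

open MeasureTheory AddCircle in
/-- The Fourier coefficients of a holomorphic function on the circles of an annulus, in terms of
circle integrals. -/
lemma fourierCoeff_circle [Fact (0 < 2 * Real.pi)] (G : ℂ → ℂ) {ρ : ℝ} (hρ : 0 < ρ) (k : ℤ) :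
    fourierCoeff (fun x : AddCircle (2 * Real.pi) => G (ρ * (toCircle x : ℂ))) k =
      (2 * Real.pi * Complex.I)⁻¹ * (ρ : ℂ) ^ k *
        ∮ z in C(0, ρ), (z - 0)⁻¹ • (G z * z ^ (-k)) := by
  rw [fourierCoeff_eq_intervalIntegral _ k 0, circleIntegral, zero_add,
    ← intervalIntegral.integral_const_mul, ← intervalIntegral.integral_smul]
  congr 1
  ext θ
  have hρ' : (ρ : ℂ) ≠ 0 := Complex.ofReal_ne_zero.2 hρ.ne'
  have hpi : (Real.pi : ℂ) ≠ 0 := Complex.ofReal_ne_zero.2 Real.pi_ne_zero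
  have hc : (toCircle (θ : AddCircle (2 * Real.pi)) : ℂ) = Complex.exp (θ * Complex.I) := by
    rw [toCircle_apply_mk, Circle.coe_exp, div_self (by positivity), one_mul]
  rw [fourier_apply, toCircle_zsmul, Circle.coe_zpow, hc, deriv_circleMap, sub_zero, circleMap,
    zero_add]
  have he : Complex.exp (θ * Complex.I) ≠ 0 := Complex.exp_ne_zero _
  set e := Complex.exp (θ * Complex.I)
  simp only [smul_eq_mul, mul_zpow, zpow_neg]
  rw [Complex.real_smul]
  push_cast
  have hI := Complex.I_ne_zero
  have h1 : (ρ : ℂ) ^ k ≠ 0 := zpow_ne_zero _ hρ'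
  have h2 : e ^ k ≠ 0 := zpow_ne_zero _ he
  field_simp

lemma summable_norm_laurent {g : ℤ → ℂ} {q : ℝ} (hq : 0 < q)
    (hg : ∀ (ρ : ℝ) (k : ℤ), q < ρ → ρ < q⁻¹ → ‖g k‖ * ρ ^ k ≤ 1) {ρ : ℝ} (h1 : q < ρ)
    (h2 : ρ < q⁻¹) : Summable fun k => ‖g k‖ * ρ ^ k := by
  obtain ⟨σ, hσ1, hσ2⟩ := exists_between h1
  obtain ⟨τ, hτ1, hτ2⟩ := exists_between h2
  have hρ : 0 < ρ := hq.trans h1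
  have hσ : 0 < σ := hq.trans hσ1
  have hτ : 0 < τ := hρ.trans hτ1
  apply Summable.of_nat_of_neg
  · refine Summable.of_nonneg_of_le (fun n => by positivity) (fun n => ?_)
      (summable_geometric_of_lt_one (r := ρ / τ) (by positivity) ((div_lt_one hτ).2 hτ1))
    have h := hg τ n (h1.trans hτ1) hτ2
    rw [zpow_natCast] at h ⊢
    rw [div_pow, le_div_iff₀ (by positivity)]
    calc ‖g n‖ * ρ ^ n * τ ^ n = ‖g n‖ * τ ^ n * ρ ^ n := by ring
      _ ≤ 1 * ρ ^ n := by gcongr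
      _ = ρ ^ n := one_mul _
  · refine Summable.of_nonneg_of_le (fun n => by positivity) (fun n => ?_)
      (summable_geometric_of_lt_one (r := σ / ρ) (by positivity) ((div_lt_one hρ).2 hσ2))
    have h := hg σ (-n) hσ1 (hσ2.trans h2)
    rw [zpow_neg, zpow_natCast] at h ⊢
    rw [div_pow, ← div_eq_mul_inv]
    rw [← div_eq_mul_inv, div_le_one (by positivity)] at h
    gcongr

open MeasureTheory AddCircle in
/-- Laurent expansion of a holomorphic function bounded by `1` on an annulus. -/
lemma exists_laurent {G : ℂ → ℂ} {q : ℝ} (hq : 0 < q)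
    (hG : ∀ z : ℂ, q < ‖z‖ → ‖z‖ < q⁻¹ → DifferentiableAt ℂ G z)
    (hb : ∀ z : ℂ, q < ‖z‖ → ‖z‖ < q⁻¹ → ‖G z‖ ≤ 1) (hq1 : q < 1) :
    ∃ g : ℤ → ℂ, (∀ ρ : ℝ, q < ρ → ρ < q⁻¹ → Summable fun k => ‖g k‖ * ρ ^ k) ∧
      ∀ z : ℂ, q < ‖z‖ → ‖z‖ < q⁻¹ → HasSum (fun k => g k * z ^ k) (G z) := by
  have : Fact (0 < 2 * Real.pi) := ⟨by positivity⟩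
  set U : ℝ → AddCircle (2 * Real.pi) → ℂ := fun ρ x => G (ρ * (toCircle x : ℂ)) with hU
  set g : ℤ → ℂ := fun k => fourierCoeff (U 1) k with hg
  have hinv : (1 : ℝ) < q⁻¹ := (one_lt_inv₀ hq).2 hq1
  have hnorm : ∀ {ρ : ℝ} (x : AddCircle (2 * Real.pi)), 0 < ρ →
      ‖(ρ : ℂ) * (toCircle x : ℂ)‖ = ρ := by
    intro ρ x hρ
    rw [norm_mul, Circle.norm_coe, mul_one, Complex.norm_real, Real.norm_eq_abs, abs_of_pos hρ]
  have hUc : ∀ ρ : ℝ, q < ρ → ρ < q⁻¹ → Continuous (U ρ) := by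
    intro ρ h1 h2
    rw [continuous_iff_continuousAt]
    intro x
    have hx := hnorm x (hq.trans h1)
    refine ContinuousAt.comp (f := fun x : AddCircle (2 * Real.pi) => (ρ : ℂ) * (toCircle x : ℂ))
      (hG _ (by rwa [hx]) (by rwa [hx])).continuousAt ?_
    exact (continuous_const.mul (continuous_subtype_val.comp continuous_toCircle)).continuousAt
  have hmono : ∀ (r R : ℝ) (k : ℤ), q < r → r ≤ R → R < q⁻¹ →
      (∮ z in C(0, R), (z - 0)⁻¹ • (G z * z ^ (-k))) =
        ∮ z in C(0, r), (z - 0)⁻¹ • (G z * z ^ (-k)) := by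
    intro r R k hr hrR hR
    have hr0 := hq.trans hr
    have hd : ∀ z : ℂ, r ≤ ‖z‖ → ‖z‖ ≤ R → DifferentiableAt ℂ (fun z => G z * z ^ (-k)) z := by
      intro z h1 h2
      have hz : z ≠ 0 := by
        rintro rfl
        rw [norm_zero] at h1
        linarith
      exact (hG z (hr.trans_le h1) (h2.trans_lt hR)).mul (differentiableAt_zpow.2 (Or.inl hz))
    refine Complex.circleIntegral_sub_center_inv_smul_eq_of_differentiable_on_annulus_off_countable
      hr0 hrR Set.countable_empty (fun z hz => ?_) (fun z hz => ?_)
    · have h1 : ‖z‖ ≤ R := by simpa using hz.1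
      have h2 : r ≤ ‖z‖ := by simpa using hz.2
      exact (hd z h2 h1).continuousAt.continuousWithinAt
    · have h1 : ‖z‖ < R := by simpa using hz.1.1
      have h2 : r < ‖z‖ := by simpa using hz.1.2
      exact hd z h2.le h1.le
  have hcoeff : ∀ (ρ : ℝ) (k : ℤ), q < ρ → ρ < q⁻¹ → fourierCoeff (U ρ) k = g k * (ρ : ℂ) ^ k := by
    intro ρ k h1 h2
    have hρ := hq.trans h1
    have e : (∮ z in C(0, ρ), (z - 0)⁻¹ • (G z * z ^ (-k))) =
        ∮ z in C(0, 1), (z - 0)⁻¹ • (G z * z ^ (-k)) := by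
      rcases le_total ρ 1 with h | h
      · exact (hmono ρ 1 k h1 h hinv).symm
      · exact hmono 1 ρ k hq1 h h2
    simp only [hg, hU]
    rw [fourierCoeff_circle G hρ, fourierCoeff_circle G one_pos, e]
    push_cast
    rw [one_zpow]
    ring
  have hdecay : ∀ (ρ : ℝ) (k : ℤ), q < ρ → ρ < q⁻¹ → ‖g k‖ * ρ ^ k ≤ 1 := by
    intro ρ k h1 h2
    have hρ := hq.trans h1
    have e : ‖g k‖ * ρ ^ k = ‖fourierCoeff (U ρ) k‖ := by
      rw [hcoeff ρ k h1 h2, norm_mul, norm_zpow, Complex.norm_real, Real.norm_eq_abs,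
        abs_of_pos hρ]
    rw [e, fourierCoeff]
    have := norm_integral_le_of_norm_le_const (μ := haarAddCircle (T := 2 * Real.pi)) (C := 1)
      (f := fun x => fourier (-k) x • U ρ x) (Filter.Eventually.of_forall fun x => by
        rw [norm_smul, fourier_apply, Circle.norm_coe, one_mul]
        have hx := hnorm x hρ
        exact hb _ (by rwa [hx]) (by rwa [hx]))
    simpa using this
  have hsum : ∀ ρ : ℝ, q < ρ → ρ < q⁻¹ → Summable fun k => ‖g k‖ * ρ ^ k :=
    fun ρ h1 h2 => summable_norm_laurent hq hdecay h1 h2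
  refine ⟨g, hsum, fun z h1 h2 => ?_⟩
  have hz : 0 < ‖z‖ := hq.trans h1
  have hzc : (‖z‖ : ℂ) ≠ 0 := Complex.ofReal_ne_zero.2 hz.ne'
  set f : C(AddCircle (2 * Real.pi), ℂ) := ⟨U ‖z‖, hUc _ h1 h2⟩ with hf
  have hfc : ∀ k, fourierCoeff f k = g k * (‖z‖ : ℂ) ^ k := fun k => hcoeff _ k h1 h2
  have hfs : Summable (fourierCoeff f) := by
    refine Summable.of_norm ?_
    simp only [hfc, norm_mul, norm_zpow, Complex.norm_real, Real.norm_eq_abs, abs_norm]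
    exact hsum _ h1 h2
  have h := has_pointwise_sum_fourier_series_of_summable hfs ((Complex.arg z : ℝ) :
    AddCircle (2 * Real.pi))
  have hc : (‖z‖ : ℂ) * (toCircle ((Complex.arg z : ℝ) : AddCircle (2 * Real.pi)) : ℂ) = z := by
    rw [toCircle_apply_mk, Circle.coe_exp, div_self (by positivity), one_mul]
    exact Complex.norm_mul_exp_arg_mul_I z
  have e1 : f ((Complex.arg z : ℝ) : AddCircle (2 * Real.pi)) = G z := by
    change G _ = G z
    rw [hc]
  rw [e1] at h
  refine h.congr_fun fun k => ?_
  rw [hfc, smul_eq_mul, fourier_apply, toCircle_zsmul, Circle.coe_zpow, mul_assoc, ← mul_zpow, hc]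

lemma joukowski_mem_ellipseRegion {h : ℝ} {z : ℂ} (h1 : Real.exp (-h) < ‖z‖)
    (h2 : ‖z‖ < (Real.exp (-h))⁻¹) : (z + z⁻¹) / 2 ∈ ellipseRegion (2 * Real.cosh h) := by
  have hz : 0 < ‖z‖ := (Real.exp_pos _).trans h1
  have hz0 : z ≠ 0 := norm_pos_iff.1 hz
  rw [← Real.exp_neg, neg_neg] at h2
  have e1 : (z + z⁻¹) / 2 - 1 = (z - 1) * (z - 1) / (2 * z) := by field_simp; ring
  have e2 : (z + z⁻¹) / 2 + 1 = (z + 1) * (z + 1) / (2 * z) := by field_simp; ring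
  have hpar := parallelogram_law_with_norm ℝ z 1
  simp only [ellipseRegion, Set.mem_ofPred_eq, e1, e2, norm_div, norm_mul, Complex.norm_ofNat,
    norm_one] at hpar ⊢
  have e3 : ‖z - 1‖ * ‖z - 1‖ / (2 * ‖z‖) + ‖z + 1‖ * ‖z + 1‖ / (2 * ‖z‖) =
      2 * Real.cosh (Real.log ‖z‖) := by
    rw [Real.cosh_log hz, ← add_div, add_comm, ← sq, ← sq, hpar]
    field_simp
  rw [e3]
  have : |Real.log ‖z‖| < |h| := by
    have h3 := (Real.lt_log_iff_exp_lt hz).2 h1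
    have h4 := (Real.log_lt_iff_lt_exp hz).2 h2
    exact (abs_lt.2 ⟨h3, h4⟩).trans_le (le_abs_self h)
  have := Real.cosh_lt_cosh.2 this
  linarith

/-- A Laurent series bounded by `1` on the circles of radii `r` and `1 / r` is within
`2 rⁿ + r²ⁿ` of a Laurent polynomial with exponents in `(-n, n)` on the unit circle. -/
lemma exists_laurentPolynomial_approx {G : ℂ → ℂ} {q r : ℝ} (hq : 0 < q) (hq1 : q < 1)
    (hqr : q < r) (hr1 : r < 1) (hG : ∀ z : ℂ, q < ‖z‖ → ‖z‖ < q⁻¹ → DifferentiableAt ℂ G z)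
    (hb : ∀ z : ℂ, q < ‖z‖ → ‖z‖ < q⁻¹ → ‖G z‖ ≤ 1) (n : ℕ) :
    ∃ p : ℤ → ℂ, ∀ z : ℂ, ‖z‖ = 1 →
      ‖G z - ∑ k ∈ Finset.Ioo (-(n : ℤ)) n, p k * z ^ k‖ ≤ 2 * r ^ n + r ^ (2 * n) := by
  obtain ⟨g, hgs, hgG⟩ := exists_laurent hq hG hb hq1
  have hr0 : 0 < r := hq.trans hqr
  have hinv1 : (1 : ℝ) < q⁻¹ := (one_lt_inv₀ hq).2 hq1
  have hrinv : r⁻¹ < q⁻¹ := (inv_lt_inv₀ hr0 hq).2 hqr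
  have hqinv : q < r⁻¹ := hq1.trans ((one_lt_inv₀ hr0).2 hr1)
  have hrq : r < q⁻¹ := hr1.trans hinv1
  have bound : ∀ ρ : ℝ, q < ρ → ρ < q⁻¹ → (Summable fun k => ‖g k * (ρ : ℂ) ^ k‖) ∧
      ∀ z : ℂ, ‖z‖ = 1 → ‖∑' k, g k * (ρ : ℂ) ^ k * z ^ k‖ ≤ 1 := by
    intro ρ h1 h2
    have hρ := hq.trans h1
    refine ⟨?_, fun z hz => ?_⟩
    · simpa only [norm_mul, norm_zpow, Complex.norm_real, Real.norm_eq_abs, abs_of_pos hρ]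
        using hgs ρ h1 h2
    · have hn : ‖(ρ : ℂ) * z‖ = ρ := by
        rw [norm_mul, hz, mul_one, Complex.norm_real, Real.norm_eq_abs, abs_of_pos hρ]
      have h3 := hgG (ρ * z) (by rwa [hn]) (by rwa [hn])
      simp only [mul_zpow, ← mul_assoc] at h3
      rw [h3.tsum_eq]
      exact hb _ (by rwa [hn]) (by rwa [hn])
  obtain ⟨hs1, hb1⟩ := bound _ hqinv hrinv
  obtain ⟨hs2, hb2⟩ := bound _ hqr hrq
  obtain ⟨hs3, hb3⟩ := bound 1 hq1 hinv1
  have hsq1 : r ^ 2 < 1 := by nlinarith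
  set a : ℤ → ℂ := fun k => (r : ℂ) ^ n *
    (((r ^ (k - (n : ℤ)).natAbs : ℝ) : ℂ) * (g k * ((r⁻¹ : ℝ) : ℂ) ^ k)) with ha
  set b : ℤ → ℂ := fun k => (r : ℂ) ^ n *
    (((r ^ (k - (-(n : ℤ))).natAbs : ℝ) : ℂ) * (g k * (r : ℂ) ^ k)) with hb'
  set c : ℤ → ℂ := fun k => (r : ℂ) ^ (2 * n) * ((((r ^ 2) ^ k.natAbs : ℝ) : ℂ) * g k) with hc
  have hrc : (r : ℂ) ≠ 0 := Complex.ofReal_ne_zero.2 hr0.ne'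
  refine ⟨fun k => g k - a k - b k + c k, fun z hz => ?_⟩
  have hsum : ∀ (w : ℤ → ℝ) (v : ℤ → ℂ), (∀ k, 0 ≤ w k ∧ w k ≤ 1) → (Summable fun k => ‖v k‖) →
      Summable fun k => ((w k : ℝ) : ℂ) * (v k * z ^ k) := by
    intro w v hw hv
    refine Summable.of_norm (Summable.of_nonneg_of_le (fun k => norm_nonneg _) (fun k => ?_) hv)
    rw [norm_mul, norm_mul, norm_zpow, hz, one_zpow, mul_one, Complex.norm_real,
      Real.norm_eq_abs, abs_of_nonneg (hw k).1]
    exact mul_le_of_le_one_left (norm_nonneg _) (hw k).2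
  have hgz := hgG z (by rw [hz]; exact hq1) (by rw [hz]; exact hinv1)
  have hA := (hsum (fun k => r ^ (k - (n : ℤ)).natAbs) _
    (fun k => ⟨by positivity, pow_le_one₀ hr0.le hr1.le⟩) hs1).hasSum.mul_left ((r : ℂ) ^ n)
  have hB := (hsum (fun k => r ^ (k - (-(n : ℤ))).natAbs) _
    (fun k => ⟨by positivity, pow_le_one₀ hr0.le hr1.le⟩) hs2).hasSum.mul_left ((r : ℂ) ^ n)
  have hs3' : Summable fun k => ‖g k‖ := by simpa using hs3
  have hC := (hsum (fun k => (r ^ 2) ^ k.natAbs) _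
    (fun k => ⟨by positivity, pow_le_one₀ (by positivity) hsq1.le⟩) hs3').hasSum.mul_left
      ((r : ℂ) ^ (2 * n))
  have hnA := norm_tsum_pow_natAbs_sub_mul_le hs1 hb1 hr0.le hr1 n hz
  have hnB := norm_tsum_pow_natAbs_sub_mul_le hs2 hb2 hr0.le hr1 (-(n : ℤ)) hz
  have hnC := norm_tsum_pow_natAbs_sub_mul_le hs3' (by simpa using hb3) (sq_nonneg r) hsq1 0 hz
  simp only [sub_zero] at hnC
  have htot := ((hgz.sub hA).sub hB).add hC
  have hzero : ∀ k ∉ Finset.Ioo (-(n : ℤ)) n, (g k - a k - b k + c k) * z ^ k = 0 := by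
    intro k hk
    have : g k - a k - b k + c k = 0 := by
      simp only [ha, hb', hc]
      rw [Finset.mem_Ioo, not_and_or, not_lt, not_lt] at hk
      rw [Complex.ofReal_inv]
      push_cast
      rcases hk with hk | hk
      · obtain ⟨m, rfl⟩ : ∃ m : ℕ, k = -((n + m : ℕ) : ℤ) := ⟨(-k - n).toNat, by omega⟩
        rw [show (-((n + m : ℕ) : ℤ) - (n : ℤ)).natAbs = 2 * n + m by omega,
          show (-((n + m : ℕ) : ℤ) - (-(n : ℤ))).natAbs = m by omega,
          Int.natAbs_neg, Int.natAbs_natCast]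
        simp only [zpow_neg, zpow_natCast, inv_pow, inv_inv]
        field_simp
        ring
      · obtain ⟨m, rfl⟩ : ∃ m : ℕ, k = ((n + m : ℕ) : ℤ) := ⟨(k - n).toNat, by omega⟩
        rw [show (((n + m : ℕ) : ℤ) - (n : ℤ)).natAbs = m by omega,
          show (((n + m : ℕ) : ℤ) - (-(n : ℤ))).natAbs = 2 * n + m by omega,
          Int.natAbs_natCast]
        simp only [zpow_natCast, inv_pow]
        field_simp
        ring
    rw [this, zero_mul]
  have hfin : HasSum (fun k => (g k - a k - b k + c k) * z ^ k)
      (∑ k ∈ Finset.Ioo (-(n : ℤ)) n, (g k - a k - b k + c k) * z ^ k) :=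
    hasSum_sum_of_ne_finset_zero hzero
  have heq := hfin.unique (htot.congr_fun fun k => by simp only [ha, hb', hc]; ring)
  beta_reduce
  rw [heq]
  refine le_trans (le_of_eq (congrArg norm ?_)) (norm_add_le_of_le (norm_add_le_of_le
    (r₁ := r ^ n) (a₁ := (r : ℂ) ^ n * ∑' k : ℤ, ((r ^ (k - (n : ℤ)).natAbs : ℝ) : ℂ) *
      (g k * ((r⁻¹ : ℝ) : ℂ) ^ k * z ^ k))
    (r₂ := r ^ n) (a₂ := (r : ℂ) ^ n * ∑' k : ℤ, ((r ^ (k - (-(n : ℤ))).natAbs : ℝ) : ℂ) *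
      (g k * (r : ℂ) ^ k * z ^ k)) ?_ ?_)
    (r₂ := r ^ (2 * n)) (a₂ := -((r : ℂ) ^ (2 * n) * ∑' k : ℤ, (((r ^ 2) ^ k.natAbs : ℝ) : ℂ) *
      (g k * z ^ k))) ?_) |>.trans (by linarith)
  · ring
  all_goals
    simp only [norm_neg, norm_mul, norm_pow, Complex.norm_real, Real.norm_eq_abs, abs_of_pos hr0]
    exact mul_le_of_le_one_right (by positivity) (by assumption)

/-- Functions bounded by `1` on an elliptic region are approximated by real polynomials of degree
less than `n` on the focal segment with error `2 rⁿ + r²ⁿ`. -/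
theorem exists_polynomial_approx {F : ℂ → ℂ} {h r : ℝ} (hh : 0 < h)
    (hF : DifferentiableOn ℂ F (ellipseRegion (2 * Real.cosh h)))
    (hb : ∀ s ∈ ellipseRegion (2 * Real.cosh h), ‖F s‖ ≤ 1) {n : ℕ} (hn : 0 < n)
    (hr : Real.exp (-h) < r) (hr1 : r < 1) :
    ∃ P : Polynomial ℝ, P.natDegree < n ∧
      ∀ x ∈ Set.Icc (-1 : ℝ) 1, |(F x).re - P.eval x| ≤ 2 * r ^ n + r ^ (2 * n) := by
  have hq1 : Real.exp (-h) < 1 := by rw [Real.exp_lt_one_iff]; linarith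
  have hd : ∀ z : ℂ, Real.exp (-h) < ‖z‖ → ‖z‖ < (Real.exp (-h))⁻¹ →
      DifferentiableAt ℂ (fun z => F ((z + z⁻¹) / 2)) z := fun z h1 h2 => by
    have hz0 : z ≠ 0 := norm_pos_iff.1 ((Real.exp_pos _).trans h1)
    have hF' := hF.differentiableAt ((isOpen_ellipseRegion _).mem_nhds
      (joukowski_mem_ellipseRegion h1 h2))
    exact DifferentiableAt.comp (f := fun z : ℂ => (z + z⁻¹) / 2) z hF'
      ((differentiableAt_id.add (differentiableAt_inv hz0)).div_const 2)
  obtain ⟨p, hp⟩ := exists_laurentPolynomial_approx (Real.exp_pos _) hq1 hr hr1 hd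
    (fun z h1 h2 => hb _ (joukowski_mem_ellipseRegion h1 h2)) n
  refine ⟨∑ k ∈ Finset.Ioo (-(n : ℤ)) n, Polynomial.C (p k).re * Polynomial.Chebyshev.T ℝ k,
    ?_, fun x hx => ?_⟩
  · rw [Nat.lt_iff_le_pred hn]
    refine Polynomial.natDegree_sum_le_of_forall_le _ _ fun k hk => ?_
    refine (Polynomial.natDegree_C_mul_le _ _).trans ?_
    rw [Polynomial.Chebyshev.natDegree_T]
    rw [Finset.mem_Ioo] at hk
    omega
  · set θ := Real.arccos x with hθ
    have hcos : Real.cos θ = x := Real.cos_arccos hx.1 hx.2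
    set z : ℂ := Complex.exp (θ * Complex.I) with hz
    have hzn : ‖z‖ = 1 := Complex.norm_exp_ofReal_mul_I θ
    have hzinv : z⁻¹ = Complex.exp (-(θ * Complex.I)) := (Complex.exp_neg _).symm
    have hzz : (z + z⁻¹) / 2 = (x : ℂ) := by
      rw [hzinv, ← hcos, Complex.ofReal_cos, Complex.cos, neg_mul]
    have h1 := hp z hzn
    have h2 := hp z⁻¹ (by rw [norm_inv, hzn, inv_one])
    rw [inv_inv, add_comm z⁻¹ z] at h2
    rw [hzz] at h1 h2
    have e : (F x).re - Polynomial.eval x (∑ k ∈ Finset.Ioo (-(n : ℤ)) n,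
        Polynomial.C (p k).re * Polynomial.Chebyshev.T ℝ k) =
        (((F x - ∑ k ∈ Finset.Ioo (-(n : ℤ)) n, p k * z ^ k) +
          (F x - ∑ k ∈ Finset.Ioo (-(n : ℤ)) n, p k * z⁻¹ ^ k)) / 2).re := by
      have e1 : ((F x - ∑ k ∈ Finset.Ioo (-(n : ℤ)) n, p k * z ^ k) +
          (F x - ∑ k ∈ Finset.Ioo (-(n : ℤ)) n, p k * z⁻¹ ^ k)) / 2 =
          F x - ∑ k ∈ Finset.Ioo (-(n : ℤ)) n, p k * ((Real.cos (k * θ) : ℝ) : ℂ) := by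
        have e2 : ∀ k : ℤ, p k * ((Real.cos (k * θ) : ℝ) : ℂ) =
            (p k * z ^ k + p k * z⁻¹ ^ k) / 2 := by
          intro k
          rw [hzinv, hz, ← Complex.exp_int_mul, ← Complex.exp_int_mul, Complex.ofReal_cos,
            Complex.cos]
          push_cast
          ring_nf
        simp only [e2, ← Finset.sum_div, Finset.sum_add_distrib]
        ring
      rw [e1, Complex.sub_re, Complex.re_sum, Polynomial.eval_finsetSum]
      congr 1
      refine Finset.sum_congr rfl fun k _ => ?_
      rw [Polynomial.eval_mul, Polynomial.eval_C, ← hcos, Polynomial.Chebyshev.T_real_cos,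
        Complex.re_mul_ofReal]
    rw [e]
    refine (Complex.abs_re_le_norm _).trans ?_
    rw [norm_div, Complex.norm_ofNat, div_le_iff₀ two_pos]
    refine (norm_add_le _ _).trans ?_
    linarith

/-- The spectral measure of a symmetric operator on a finite-dimensional space with respect to a
vector. -/
lemma LinearMap.IsSymmetric.exists_spectral_weights {V : Type*} [NormedAddCommGroup V]
    [InnerProductSpace ℝ V] [FiniteDimensional ℝ V] {n : ℕ} (hn : Module.finrank ℝ V = n)
    {T : V →ₗ[ℝ] V} (hT : T.IsSymmetric)
    (hle : ∀ u, |inner ℝ (T u) u| ≤ inner ℝ u u) (v : V) :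
    ∃ s w : Fin n → ℝ, (∀ i, s i ∈ Set.Icc (-1 : ℝ) 1) ∧ (∀ i, 0 ≤ w i) ∧
      ∀ j k : ℕ, inner ℝ ((T ^ j) v) ((T ^ k) v) = ∑ i, w i * s i ^ (j + k) := by
  set e := hT.eigenvectorBasis hn
  set s := hT.eigenvalues hn
  have he : ∀ i, T (e i) = s i • e i := fun i => hT.apply_eigenvectorBasis hn i
  have hpow : ∀ (j : ℕ) (i : Fin n), inner ℝ ((T ^ j) v) (e i) = s i ^ j * inner ℝ v (e i) := by
    intro j i
    induction j with
    | zero => simp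
    | succ j ih =>
      rw [pow_succ', Module.End.mul_apply, hT, he, real_inner_smul_right, ih]
      ring
  refine ⟨s, fun i => inner ℝ v (e i) ^ 2, fun i => ?_, fun i => sq_nonneg _, fun j k => ?_⟩
  · have h := hle (e i)
    rw [he, real_inner_smul_left, real_inner_self_eq_norm_sq, e.norm_eq_one] at h
    simpa [abs_le] using h
  · rw [← e.sum_inner_mul_inner]
    refine Finset.sum_congr rfl fun i _ => ?_
    rw [real_inner_comm _ (e i), hpow, hpow]
    ring

open Polynomial in
/-- Gaussian quadrature with `M` nodes for a functional on polynomials which is nonnegative on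
`[-1, 1]` and positive on squares of nonzero polynomials of degree less than `M`. -/
theorem exists_gauss_quadrature (A : ℝ[X] →ₗ[ℝ] ℝ) {M : ℕ} (hM : 1 ≤ M)
    (hnonneg : ∀ P : ℝ[X], (∀ x ∈ Set.Icc (-1 : ℝ) 1, 0 ≤ P.eval x) → 0 ≤ A P)
    (hpos : ∀ P : ℝ[X], P ≠ 0 → P.degree < M → 0 < A (P * P)) :
    ∃ s w : Fin M → ℝ, (∀ i, s i ∈ Set.Icc (-1 : ℝ) 1) ∧ (∀ i, 0 ≤ w i) ∧
      ∀ P : ℝ[X], P.natDegree < 2 * M → A P = ∑ i, w i * P.eval (s i) := by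
  set V := degreeLT ℝ M with hV
  set B : ℝ[X] →ₗ[ℝ] ℝ[X] →ₗ[ℝ] ℝ := (LinearMap.mul ℝ ℝ[X]).compr₂ A with hB
  have hBapply : ∀ p q, B p q = A (p * q) := fun p q => rfl
  have hfd : FiniteDimensional ℝ V := (degreeLTEquiv ℝ M).symm.finiteDimensional
  have hrank : Module.finrank ℝ V = M := by
    rw [(degreeLTEquiv ℝ M).finrank_eq]; simp
  have hposV : ∀ u : V, u ≠ 0 → 0 < A ((u : ℝ[X]) * u) := fun u hu =>
    hpos u (by simpa using hu) (mem_degreeLT.1 u.2)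
  set Φ : V →ₗ[ℝ] Module.Dual ℝ V := B.domRestrict₁₂ V V with hΦ
  have hΦapply : ∀ u v : V, Φ u v = A ((u : ℝ[X]) * v) := fun u v => rfl
  have hinj : Function.Injective Φ := by
    rw [← LinearMap.ker_eq_bot, LinearMap.ker_eq_bot']
    intro u hu
    by_contra h
    have h1 := hposV u h
    rw [← hΦapply, hu] at h1
    simp at h1
  let E : V ≃ₗ[ℝ] Module.Dual ℝ V :=
    LinearMap.linearEquivOfInjective Φ hinj (Subspace.dual_finrank_eq).symm
  let T : V →ₗ[ℝ] V := E.symm.toLinearMap ∘ₗ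
    ((B ∘ₗ LinearMap.mulLeft ℝ (X : ℝ[X])).domRestrict₁₂ V V)
  have hT : ∀ u v : V, A ((T u : ℝ[X]) * v) = A ((X : ℝ[X]) * (u : ℝ[X]) * (v : ℝ[X])) := by
    intro u v
    rw [← hΦapply]
    have : E (T u) = (B ∘ₗ LinearMap.mulLeft ℝ (X : ℝ[X])).domRestrict₁₂ V V u :=
      E.apply_symm_apply _
    change (E (T u)) v = _
    rw [this]
    rfl
  have hTX : ∀ (u : V) (h : (X : ℝ[X]) * (u : ℝ[X]) ∈ V), T u = ⟨(X : ℝ[X]) * (u : ℝ[X]), h⟩ := by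
    intro u h
    apply hinj
    ext v
    rw [hΦapply, hΦapply, hT]
  let core : InnerProductSpace.Core ℝ V :=
    { inner := fun u v => A ((u : ℝ[X]) * v)
      conj_inner_symm := fun u v => by simp [mul_comm]
      re_inner_nonneg := fun u => by
        rcases eq_or_ne u 0 with rfl | hu
        · simp
        · exact (hposV u hu).le
      add_left := fun u v w => by simp [add_mul]
      smul_left := fun u v c => by simp
      definite := fun u hu => by
        by_contra h
        exact (hposV u h).ne' hu }
  let _ : NormedAddCommGroup V := core.toNormedAddCommGroup
  let _ : InnerProductSpace ℝ V := InnerProductSpace.ofCore core.toCore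
  have hinner : ∀ u v : V, inner ℝ u v = A ((u : ℝ[X]) * v) := fun u v => rfl
  have hsymm : T.IsSymmetric := fun u v => by
    rw [hinner, hinner, hT, mul_comm (u : ℝ[X]), hT]
    congr 1
    ring
  have hone : (1 : ℝ[X]) ∈ V := by
    rw [mem_degreeLT, degree_one]
    exact_mod_cast hM
  obtain ⟨s, w, hs, hw, hsw⟩ := hsymm.exists_spectral_weights hrank (fun u => by
    rw [hinner, hinner, hT]
    have h1 := hnonneg ((1 - X) * ((u : ℝ[X]) * (u : ℝ[X]))) fun x hx => by
      simp only [eval_mul, eval_sub, eval_one, eval_X]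
      exact mul_nonneg (by linarith [hx.2]) (mul_self_nonneg _)
    have h2 := hnonneg ((1 + X) * ((u : ℝ[X]) * (u : ℝ[X]))) fun x hx => by
      simp only [eval_mul, eval_add, eval_one, eval_X]
      exact mul_nonneg (by linarith [hx.1]) (mul_self_nonneg _)
    rw [sub_mul, one_mul, map_sub, ← mul_assoc] at h1
    rw [add_mul, one_mul, map_add, ← mul_assoc X] at h2
    exact abs_le.2 ⟨by linarith, by linarith⟩) ⟨1, hone⟩
  have hpow : ∀ j : ℕ, j < M → (((T ^ j) ⟨1, hone⟩ : V) : ℝ[X]) = X ^ j := by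
    intro j
    induction j with
    | zero => intro _; simp
    | succ j ih =>
      intro hj
      have h1 := ih (by omega)
      have h2 : X * (((T ^ j) ⟨1, hone⟩ : V) : ℝ[X]) ∈ V := by
        rw [h1, ← pow_succ', mem_degreeLT, degree_X_pow]
        exact_mod_cast hj
      rw [pow_succ', Module.End.mul_apply, hTX _ h2]
      change X * (((T ^ j) ⟨1, hone⟩ : V) : ℝ[X]) = _
      rw [h1, ← pow_succ']
  have hmono : ∀ m : ℕ, m < 2 * M → A (X ^ m) = ∑ i, w i * s i ^ m := by
    intro m hm
    rcases Nat.eq_zero_or_pos m with rfl | hm0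
    · have h := hsw 0 0
      rw [hinner, hpow 0 (by omega)] at h
      simpa using h
    · obtain ⟨j, k, hj, hk, rfl⟩ : ∃ j k : ℕ, j < M ∧ k < M ∧ m = (j + 1) + k := by
        rcases le_or_gt m M with h | h
        · exact ⟨m - 1, 0, by omega, by omega, by omega⟩
        · exact ⟨M - 1, m - M, by omega, by omega, by omega⟩
      rw [← hsw, hinner, pow_succ' T, Module.End.mul_apply, hT, hpow j hj, hpow k hk]
      congr 1
      ring
  refine ⟨s, w, hs, hw, fun P hP => ?_⟩
  conv_lhs => rw [P.as_sum_range' (2 * M) hP]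
  simp only [eval_eq_sum_range' hP, map_sum, Finset.mul_sum]
  rw [Finset.sum_comm]
  refine Finset.sum_congr rfl fun m hm => ?_
  rw [← mul_one (P.coeff m), ← smul_eq_mul, ← smul_monomial, map_smul, monomial_one_right_eq_X_pow,
    hmono m (Finset.mem_range.1 hm), smul_eq_mul, Finset.mul_sum]
  refine Finset.sum_congr rfl fun i _ => ?_
  rw [smul_eq_mul]
  ring

/-- The nodes of the uniform partition of `[a, b]` into `N + 1` parts. -/
noncomputable def uniformNode (a b : ℝ) (N i : ℕ) : ℝ := a + i * ((b - a) / (N + 1))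

/-- The left Riemann-Stieltjes sum over the uniform partition into `N + 1` parts. -/
noncomputable def stieltjesSum (W : ℝ → ℝ) (a b : ℝ) (N : ℕ) (φ : ℝ → ℝ) : ℝ :=
  ∑ i ∈ Finset.range (N + 1), φ (uniformNode a b N i) *
    (W (uniformNode a b N (i + 1)) - W (uniformNode a b N i))

section Stieltjes

variable {a b : ℝ} {W : ℝ → ℝ}

lemma uniformNode_zero (N : ℕ) : uniformNode a b N 0 = a := by simp [uniformNode]

lemma uniformNode_last (N : ℕ) : uniformNode a b N (N + 1) = b := by
  have : (N : ℝ) + 1 ≠ 0 := by positivity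
  rw [uniformNode]
  push_cast
  field_simp
  ring

lemma uniformNode_succ (N i : ℕ) :
    uniformNode a b N (i + 1) = uniformNode a b N i + (b - a) / (N + 1) := by
  simp only [uniformNode]
  push_cast
  ring

lemma uniformNode_mem (hab : a < b) {N i : ℕ} (hi : i ≤ N + 1) :
    uniformNode a b N i ∈ Set.Icc a b := by
  have h0 : 0 ≤ (b - a) / ((N : ℝ) + 1) := div_nonneg (by linarith) (by positivity)
  refine ⟨by rw [uniformNode]; have : 0 ≤ (i : ℝ) * ((b - a) / (N + 1)) := by positivity
             linarith, ?_⟩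
  have h1 := uniformNode_last (a := a) (b := b) N
  have h2 : (i : ℝ) ≤ ((N + 1 : ℕ) : ℝ) := by exact_mod_cast hi
  have h3 := mul_le_mul_of_nonneg_right h2 h0
  rw [uniformNode] at h1 ⊢
  linarith

lemma sub_uniformNode_nonneg (hab : a < b) (hW : MonotoneOn W (Set.Icc a b)) {N i : ℕ}
    (hi : i < N + 1) : 0 ≤ W (uniformNode a b N (i + 1)) - W (uniformNode a b N i) := by
  refine sub_nonneg.2 (hW (uniformNode_mem hab hi.le) (uniformNode_mem hab hi) ?_)
  have h0 : 0 ≤ (b - a) / ((N : ℝ) + 1) := div_nonneg (by linarith) (by positivity)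
  rw [uniformNode_succ]
  linarith

lemma sum_sub_uniformNode (V : ℝ → ℝ) (N : ℕ) :
    ∑ i ∈ Finset.range (N + 1), (V (uniformNode a b N (i + 1)) - V (uniformNode a b N i)) =
      V b - V a := by
  rw [Finset.sum_range_sub (fun i => V (uniformNode a b N i)), uniformNode_zero, uniformNode_last]

lemma abs_stieltjesSum_le (hab : a < b) (hW : MonotoneOn W (Set.Icc a b)) {φ : ℝ → ℝ} {C : ℝ}
    (hφ : ∀ x, |φ x| ≤ C) (N : ℕ) : |stieltjesSum W a b N φ| ≤ C * (W b - W a) := by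
  rw [← sum_sub_uniformNode W N, Finset.mul_sum]
  refine (Finset.abs_sum_le_sum_abs _ _).trans (Finset.sum_le_sum fun i hi => ?_)
  have h := sub_uniformNode_nonneg hab hW (Finset.mem_range.1 hi)
  rw [abs_mul, abs_of_nonneg h]
  exact mul_le_mul_of_nonneg_right (hφ _) h

lemma tendsto_mesh (a b : ℝ) :
    Filter.Tendsto (fun N : ℕ => (b - a) / ((N : ℝ) + 1)) Filter.atTop (nhds 0) :=
  tendsto_const_nhds.div_atTop
    (Filter.tendsto_atTop_add_const_right _ _ tendsto_natCast_atTop_atTop)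

lemma HasStieltjesIntegral.tendsto_stieltjesSum (hab : a < b) {φ : ℝ → ℝ} {I : ℝ}
    (h : HasStieltjesIntegral φ W a b I) :
    Filter.Tendsto (fun N => stieltjesSum W a b N φ) Filter.atTop (nhds I) := by
  rw [Metric.tendsto_nhds]
  intro ε hε
  obtain ⟨δ, hδ, hsum⟩ := h ε hε
  filter_upwards [(tendsto_mesh a b).eventually (gt_mem_nhds hδ)] with N hN
  have h0 : 0 ≤ (b - a) / ((N : ℝ) + 1) := div_nonneg (by linarith) (by positivity)
  refine hsum (N + 1) (uniformNode a b N) (uniformNode a b N) (uniformNode_zero N)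
    (uniformNode_last N) fun i _ => ⟨le_rfl, ?_, ?_⟩
  · rw [uniformNode_succ]; linarith
  · rw [uniformNode_succ]; linarith

lemma le_stieltjesSum (hab : a < b) (hW : MonotoneOn W (Set.Icc a b)) {φ : ℝ → ℝ} {c ε η s t : ℝ}
    (hφ : ∀ x ∈ Set.Icc a b, 0 ≤ φ x) (hη : 0 ≤ η)
    (hφc : ∀ x ∈ Set.Icc a b, |x - c| < ε → η ≤ φ x) (hs : s ∈ Set.Icc a b) (ht : t ∈ Set.Icc a b)
    (hcs : c - ε / 2 < s) (hst : s ≤ t) (htc : t < c + ε / 2) {N : ℕ}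
    (hN : (b - a) / ((N : ℝ) + 1) < ε / 2) :
    η * (W t - W s) ≤ stieltjesSum W a b N φ := by
  set V : ℝ → ℝ := fun x => W (max s (min x t)) with hV
  have hVa : V a = W s := by simp only [hV]; rw [min_eq_left ht.1, max_eq_left hs.1]
  have hVb : V b = W t := by simp only [hV]; rw [min_eq_right ht.2, max_eq_right hst]
  rw [← hVa, ← hVb, ← sum_sub_uniformNode V N, Finset.mul_sum]
  refine Finset.sum_le_sum fun i hi => ?_
  have hi' := Finset.mem_range.1 hi
  have h0 : 0 ≤ (b - a) / ((N : ℝ) + 1) := div_nonneg (by linarith) (by positivity)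
  have hΔ := sub_uniformNode_nonneg hab hW hi'
  have hx := uniformNode_mem hab hi'.le
  have hy := uniformNode_mem hab (N := N) (i := i + 1) hi'
  have hxy := uniformNode_succ (a := a) (b := b) N i
  set x := uniformNode a b N i
  set y := uniformNode a b N (i + 1)
  have hφx := hφ x hx
  rcases le_or_gt y s with h1 | h1
  · have e1 : V y = W s := by simp only [hV]; rw [max_eq_left ((min_le_left _ _).trans h1)]
    have e2 : V x = W s := by
      simp only [hV]; rw [max_eq_left ((min_le_left _ _).trans (by linarith))]
    rw [e1, e2, sub_self, mul_zero]
    positivity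
  · rcases le_or_gt t x with h2 | h2
    · have e1 : V y = W t := by
        simp only [hV]; rw [min_eq_right (by linarith), max_eq_right hst]
      have e2 : V x = W t := by simp only [hV]; rw [min_eq_right h2, max_eq_right hst]
      rw [e1, e2, sub_self, mul_zero]
      positivity
    · have hle : V y - V x ≤ W y - W x := by
        have e1 : V y ≤ W y := by
          have hm : max s (min y t) ≤ y := max_le h1.le (min_le_left _ _)
          exact hW ⟨hs.1.trans (le_max_left _ _), hm.trans hy.2⟩ hy hm
        have e2 : W x ≤ V x := by
          have hm : x ≤ max s (min x t) := (le_min le_rfl h2.le).trans (le_max_right _ _)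
          refine hW hx ⟨hx.1.trans hm, max_le hs.2 ((min_le_left _ _).trans hx.2)⟩ hm
        linarith
      have hη' := hφc x hx (abs_lt.2 ⟨by linarith, by linarith⟩)
      calc η * (V y - V x) ≤ η * (W y - W x) := by gcongr
        _ ≤ φ x * (W y - W x) := by gcongr

/-- The Riemann-Stieltjes integral with respect to a monotone function as a positive linear
functional on continuous functions, together with its positivity at points of increase. -/
theorem exists_stieltjes_functional (hab : a < b) (hW : MonotoneOn W (Set.Icc a b)) :
    ∃ L : C(Set.Icc a b, ℝ) →ₗ[ℝ] ℝ, (∀ φ, (∀ x, 0 ≤ φ x) → 0 ≤ L φ) ∧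
      (∀ (φ : C(ℝ, ℝ)) (I : ℝ), HasStieltjesIntegral φ W a b I →
        L (φ.restrict (Set.Icc a b)) = I) ∧
      ∀ (c : Set.Icc a b), (c : ℝ) ∈ pointsOfIncrease W a b → ∀ φ, (∀ x, 0 ≤ φ x) → 0 < φ c →
        0 < L φ := by
  set S : ℕ → C(Set.Icc a b, ℝ) → ℝ := fun N φ => stieltjesSum W a b N (Set.IccExtend hab.le φ)
    with hS
  have hSval : ∀ N φ, S N φ = ∑ i ∈ Finset.range (N + 1),
      Set.IccExtend hab.le φ (uniformNode a b N i) *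
        (W (uniformNode a b N (i + 1)) - W (uniformNode a b N i)) := fun _ _ => rfl
  have hex : ∀ φ, ∃ l, Filter.Tendsto (fun N => S N φ) (Filter.hyperfilter ℕ) (nhds l) := by
    intro φ
    have hb : ∀ N, S N φ ∈ Set.Icc (-(‖φ‖ * (W b - W a))) (‖φ‖ * (W b - W a)) := fun N =>
      abs_le.1 (abs_stieltjesSum_le hab hW (fun x => φ.norm_coe_le_norm _) N)
    obtain ⟨l, _, hl⟩ := (isCompact_Icc (a := -(‖φ‖ * (W b - W a)))
      (b := ‖φ‖ * (W b - W a))).ultrafilter_le_nhds ((Filter.hyperfilter ℕ).map fun N => S N φ)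
      (by
        rw [Filter.le_principal_iff]
        exact Filter.mem_map.2 (Filter.univ_mem' hb))
    exact ⟨l, hl⟩
  choose L hL using hex
  have hadd : ∀ φ ψ, L (φ + ψ) = L φ + L ψ := fun φ ψ => by
    refine tendsto_nhds_unique (hL (φ + ψ)) (((hL φ).add (hL ψ)).congr fun N => ?_)
    simp only [hSval, ← Finset.sum_add_distrib, ← add_mul]
    rfl
  have hsmul : ∀ (r : ℝ) φ, L (r • φ) = r • L φ := fun r φ => by
    refine tendsto_nhds_unique (hL (r • φ)) (((hL φ).const_smul r).congr fun N => ?_)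
    simp only [hSval, smul_eq_mul, Finset.mul_sum, ← mul_assoc]
    rfl
  refine ⟨⟨⟨L, hadd⟩, hsmul⟩, fun φ hφ => ?_, fun φ I hI => ?_, fun c hc φ hφ hcφ => ?_⟩
  · refine ge_of_tendsto' (hL φ) fun N => Finset.sum_nonneg fun i hi => mul_nonneg (hφ _) ?_
    exact sub_uniformNode_nonneg hab hW (Finset.mem_range.1 hi)
  · refine tendsto_nhds_unique (hL _)
      (((hI.tendsto_stieltjesSum hab).mono_left Nat.hyperfilter_le_atTop).congr fun N => ?_)
    rw [hSval, stieltjesSum]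
    refine Finset.sum_congr rfl fun i hi => ?_
    rw [Set.IccExtend_of_mem _ _ (uniformNode_mem hab (Finset.mem_range.1 hi).le)]
    rfl
  · have hcont : Continuous (Set.IccExtend hab.le φ) := φ.continuous.Icc_extend'
    have hval : Set.IccExtend hab.le φ c = φ c := Set.IccExtend_val _ _ _
    have hev : ∀ᶠ x in nhds (c : ℝ), φ c / 2 < Set.IccExtend hab.le φ x :=
      hcont.continuousAt.eventually_const_lt (by rw [hval]; linarith)
    obtain ⟨ε, hε, hball⟩ := Metric.eventually_nhds_iff.1 hev
    obtain ⟨s, hs, t, ht, h1, h2, h3, h4, h5⟩ := hc.2 (ε / 2) (by linarith)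
    have hpos : 0 < φ c / 2 * (W t - W s) := mul_pos (by linarith) (by linarith)
    refine hpos.trans_le (ge_of_tendsto (hL φ) ?_)
    refine Nat.hyperfilter_le_atTop ?_
    filter_upwards [(tendsto_mesh a b).eventually (gt_mem_nhds (half_pos hε))] with N hN
    exact le_stieltjesSum hab hW (fun x _ => hφ _) (by linarith)
      (fun x _ hx => (hball hx).le) hs ht h1 (h2.trans h3) h4 hN

end Stieltjes

lemma exists_eval_ne_zero_of_encard {T : Set ℝ} {M : ℕ} (hT : ((M + 1 : ℕ) : ℕ∞) ≤ T.encard)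
    {h : ℝ → ℝ} (hh : Set.InjOn h T) {P : Polynomial ℝ} (hP : P ≠ 0) (hdeg : P.natDegree ≤ M) :
    ∃ c ∈ T, P.eval (h c) ≠ 0 := by
  by_contra! hcon
  have hsub : h '' T ⊆ (P.roots.toFinset : Set ℝ) := by
    rintro _ ⟨c, hc, rfl⟩
    simp [hP, hcon c hc]
  have h1 := Set.encard_le_encard hsub
  rw [hh.encard_image, Set.encard_coe_eq_coe_finsetCard] at h1
  have h2 : P.roots.toFinset.card ≤ M :=
    (Multiset.toFinset_card_le _).trans ((Polynomial.card_roots' P).trans hdeg)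
  have h3 := hT.trans h1
  have : M + 1 ≤ P.roots.toFinset.card := by exact_mod_cast h3
  omega

/-- The Hankel matrix of a function sampled at the integers. -/
def hankelMatrix (g : ℝ → ℝ) (M : ℕ) : Matrix (Fin (M + 1)) (Fin (M + 1)) ℝ :=
  Matrix.of fun i j => g (((i : ℕ) : ℝ) + ((j : ℕ) : ℝ))

lemma det_hankelMatrix_of_mem_expSums {M : ℕ} {g : ℝ → ℝ} (hg : g ∈ expSums M) :
    (hankelMatrix g M).det = 0 := by
  obtain ⟨c, t, hct⟩ := hg
  set A : Matrix (Fin (M + 1)) (Fin M) ℝ :=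
    Matrix.of fun i ν => c ν * Real.exp (-(t ν * ((i : ℕ) : ℝ)))
  set B : Matrix (Fin M) (Fin (M + 1)) ℝ := Matrix.of fun ν j => Real.exp (-(t ν * ((j : ℕ) : ℝ)))
  have hAB : hankelMatrix g M = A * B := by
    ext i j
    rw [Matrix.mul_apply]
    simp only [hankelMatrix, Matrix.of_apply, hct, A, B]
    refine Finset.sum_congr rfl fun ν _ => ?_
    rw [mul_assoc, ← Real.exp_add]
    ring_nf
  by_contra hdet
  have h1 := Matrix.rank_of_isUnit (hankelMatrix g M)
    ((Matrix.isUnit_iff_isUnit_det _).2 (isUnit_iff_ne_zero.2 hdet))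
  have h2 : (A * B).rank ≤ M := by
    have := (Matrix.rank_mul_le_left A B).trans (Matrix.rank_le_width A)
    simpa using this
  rw [← hAB, h1, Fintype.card_fin] at h2
  omega

/-- The exponential `t ↦ exp (-x t)` as a continuous function. -/
noncomputable def expKernel (x : ℝ) : C(ℝ, ℝ) := ⟨fun t => Real.exp (-(x * t)), by fun_prop⟩

section Functional

variable {a b : ℝ} {T : Set ℝ} {M : ℕ} {f : ℝ → ℝ} {L : C(Set.Icc a b, ℝ) →ₗ[ℝ] ℝ}

lemma det_hankelMatrix_ne_zero (hTab : T ⊆ Set.Icc a b)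
    (hT : ((M + 1 : ℕ) : ℕ∞) ≤ T.encard)
    (hpos : ∀ c : Set.Icc a b, (c : ℝ) ∈ T → ∀ φ : C(Set.Icc a b, ℝ), (∀ x, 0 ≤ φ x) → 0 < φ c →
      0 < L φ)
    (hLf : ∀ x : ℝ, 0 ≤ x → L ((expKernel x).restrict (Set.Icc a b)) = f x) :
    (hankelMatrix f M).det ≠ 0 := by
  intro hdet
  obtain ⟨u, hu0, hu⟩ := Matrix.exists_mulVec_eq_zero_iff.2 hdet
  set P : Polynomial ℝ := ∑ i : Fin (M + 1), Polynomial.monomial (i : ℕ) (u i) with hP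
  have hcoeff : ∀ i : Fin (M + 1), P.coeff i = u i := by
    intro i
    rw [hP, Polynomial.finsetSum_coeff]
    simp only [Polynomial.coeff_monomial]
    rw [Finset.sum_eq_single i]
    · simp
    · intro j _ hj
      rw [if_neg]
      exact fun h => hj (Fin.ext h)
    · simp
  have hP0 : P ≠ 0 := by
    intro h
    apply hu0
    ext i
    rw [← hcoeff, h]
    simp
  have hdeg : P.natDegree ≤ M := by
    refine Polynomial.natDegree_sum_le_of_forall_le _ _ fun i _ => ?_
    exact (Polynomial.natDegree_monomial_le _).trans (by omega)
  have hinj : Set.InjOn (fun t : ℝ => Real.exp (-t)) T := fun x _ y _ h => by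
    simpa using h
  obtain ⟨c, hc, hPc⟩ := exists_eval_ne_zero_of_encard hT hinj hP0 hdeg
  set ψ : C(Set.Icc a b, ℝ) :=
    ∑ i : Fin (M + 1), u i • (expKernel ((i : ℕ) : ℝ)).restrict (Set.Icc a b) with hψ
  have hψval : ∀ x, ψ x = P.eval (Real.exp (-(x : ℝ))) := by
    intro x
    rw [hψ, hP, ContinuousMap.sum_apply, Polynomial.eval_finsetSum]
    refine Finset.sum_congr rfl fun i _ => ?_
    rw [Polynomial.eval_monomial, ← Real.exp_nat_mul]
    simp [expKernel]
  have h1 : 0 < L (ψ * ψ) := by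
    refine hpos ⟨c, hTab hc⟩ hc _ (fun x => mul_self_nonneg _) ?_
    have : ψ ⟨c, hTab hc⟩ ≠ 0 := by rw [hψval]; exact hPc
    exact mul_self_pos.2 this
  have h2 : L (ψ * ψ) = u ⬝ᵥ (hankelMatrix f M).mulVec u := by
    have hmul : ∀ i j : Fin (M + 1), (expKernel ((i : ℕ) : ℝ)).restrict (Set.Icc a b) *
        (expKernel ((j : ℕ) : ℝ)).restrict (Set.Icc a b) =
        (expKernel (((i : ℕ) : ℝ) + ((j : ℕ) : ℝ))).restrict (Set.Icc a b) := by
      intro i j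
      ext x
      simp only [expKernel, ContinuousMap.mul_apply, ContinuousMap.restrict_apply,
        ContinuousMap.coe_mk, ← Real.exp_add]
      ring_nf
    rw [hψ, Finset.sum_mul_sum, map_sum]
    simp only [dotProduct, Matrix.mulVec, Finset.mul_sum, map_sum]
    refine Finset.sum_congr rfl fun i _ => Finset.sum_congr rfl fun j _ => ?_
    rw [smul_mul_smul_comm, hmul, map_smul, hLf _ (by positivity), smul_eq_mul]
    simp only [hankelMatrix, Matrix.of_apply]
    ring
  rw [h2, hu, dotProduct_zero] at h1
  exact lt_irrefl _ h1

lemma bestUniformError_pos (hdet : (hankelMatrix f M).det ≠ 0) :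
    0 < bestUniformError f (expSums M) (Set.Ici 0) := by
  rw [pos_iff_ne_zero]
  intro h0
  have hex : ∀ n : ℕ, ∃ G ∈ expSums M, ∀ x : ℝ, 0 ≤ x → |f x - G x| ≤ 1 / ((n : ℝ) + 1) := by
    intro n
    have hlt : bestUniformError f (expSums M) (Set.Ici 0) < ENNReal.ofReal (1 / ((n : ℝ) + 1)) := by
      rw [h0]
      exact ENNReal.ofReal_pos.2 (by positivity)
    simp only [bestUniformError, iInf_lt_iff] at hlt
    obtain ⟨G, hG, hlt⟩ := hlt
    refine ⟨G, hG, fun x hx => ?_⟩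
    have := (le_iSup₂ (f := fun x (_ : x ∈ Set.Ici (0 : ℝ)) => ENNReal.ofReal |f x - G x|) x hx).trans
      hlt.le
    exact (ENNReal.ofReal_le_ofReal_iff (by positivity)).1 this
  choose G hG hGf using hex
  have hlim : Filter.Tendsto (fun n => hankelMatrix (G n) M) Filter.atTop
      (nhds (hankelMatrix f M)) := by
    refine tendsto_pi_nhds.2 fun i => tendsto_pi_nhds.2 fun j => ?_
    rw [tendsto_iff_norm_sub_tendsto_zero]
    refine squeeze_zero (fun n => norm_nonneg _) (fun n => ?_)
      (tendsto_one_div_add_atTop_nhds_zero_nat (𝕜 := ℝ))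
    rw [norm_sub_rev]
    exact hGf n _ (by positivity)
  have hd := (continuous_id.matrix_det.tendsto (hankelMatrix f M)).comp hlim
  have hz : (Matrix.det ∘ fun n => hankelMatrix (G n) M) = fun _ => 0 :=
    funext fun n => det_hankelMatrix_of_mem_expSums (hG n)
  exact hdet (tendsto_nhds_unique (hz ▸ hd) tendsto_const_nhds)

lemma bestUniformError_le {G : ℝ → ℝ} (hG : G ∈ expSums M) {C : ℝ}
    (hC : ∀ x : ℝ, 0 ≤ x → |f x - G x| ≤ C) :
    bestUniformError f (expSums M) (Set.Ici 0) ≤ ENNReal.ofReal C :=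
  iInf₂_le_of_le G hG (iSup₂_le fun x hx => ENNReal.ofReal_le_ofReal (hC x hx))

lemma abs_functional_sub_le (hnonneg : ∀ φ : C(Set.Icc a b, ℝ), (∀ x, 0 ≤ φ x) → 0 ≤ L φ)
    {φ ψ : C(Set.Icc a b, ℝ)} {δ : ℝ} (h : ∀ x, |φ x - ψ x| ≤ δ) : |L φ - L ψ| ≤ δ * L 1 := by
  have h1 := hnonneg (δ • (1 : C(Set.Icc a b, ℝ)) - (φ - ψ)) fun x => by
    have := (abs_le.1 (h x)).2
    simpa using by linarith
  have h2 := hnonneg (δ • (1 : C(Set.Icc a b, ℝ)) + (φ - ψ)) fun x => by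
    have := (abs_le.1 (h x)).1
    simp only [ContinuousMap.add_apply, ContinuousMap.smul_apply, ContinuousMap.sub_apply,
      ContinuousMap.one_apply, smul_eq_mul, mul_one]
    linarith
  simp only [map_sub, map_add, map_smul, smul_eq_mul] at h1 h2
  exact abs_le.2 ⟨by linarith, by linarith⟩

end Functional

/-- The restriction of a slit map to the focal segment has a continuous inverse. -/
lemma IsSlitMap.exists_inverse {a b ω : ℝ} {φ : ℂ → ℂ} (h : IsSlitMap a b ω φ) (hω : 2 < ω) :
    ∃ σ : C(Set.Icc a b, ℝ), (∀ t, σ t ∈ Set.Icc (-1 : ℝ) 1) ∧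
      ∀ t, φ (σ t) = ((t : ℝ) : ℂ) := by
  have hmem : ∀ x ∈ Set.Icc (-1 : ℝ) 1, (x : ℂ) ∈ ellipseRegion ω := fun x hx =>
    ofReal_mem_ellipseRegion hω (abs_le.2 hx)
  set ψ : ℝ → ℝ := fun x => (φ x).re with hψ
  have hcont : ContinuousOn ψ (Set.Icc (-1) 1) :=
    Complex.continuous_re.comp_continuousOn
      (h.differentiableOn.continuousOn.comp Complex.continuous_ofReal.continuousOn hmem)
  have hmono : StrictMonoOn ψ (Set.Icc (-1) 1) := fun x hx y hy hxy =>
    h.re_lt_re x y (hmem x hx) (hmem y hy) hxy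
  have hψa : ψ (-1) = a := by simp [hψ, h.map_neg_one]
  have hψb : ψ 1 = b := by simp [hψ, h.map_one]
  have hmaps : ∀ x : Set.Icc (-1 : ℝ) 1, ψ x ∈ Set.Icc a b := fun x => by
    have hx := x.2
    rw [← hψa, ← hψb]
    exact ⟨hmono.monotoneOn ⟨le_rfl, by norm_num⟩ hx hx.1,
      hmono.monotoneOn hx ⟨by norm_num, le_rfl⟩ hx.2⟩
  set F : Set.Icc (-1 : ℝ) 1 → Set.Icc a b := fun x => ⟨ψ x, hmaps x⟩ with hF
  have hFc : Continuous F := (continuousOn_iff_continuous_domRestrict.1 hcont).subtype_mk _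
  have hFbij : Function.Bijective F := by
    refine ⟨fun x y hxy => Subtype.ext (hmono.injOn x.2 y.2 (congrArg Subtype.val hxy)),
      fun t => ?_⟩
    have ht : (t : ℝ) ∈ Set.Icc (ψ (-1)) (ψ 1) := by rw [hψa, hψb]; exact t.2
    obtain ⟨x, hx, hxt⟩ := intermediate_value_Icc (by norm_num) hcont ht
    exact ⟨⟨x, hx⟩, Subtype.ext hxt⟩
  set e := Continuous.homeoOfEquivCompactToT2 (f := Equiv.ofBijective F hFbij) hFc
  refine ⟨⟨fun t => (e.symm t : ℝ), continuous_subtype_val.comp e.symm.continuous⟩,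
    fun t => (e.symm t).2, fun t => ?_⟩
  have h1 : F (e.symm t) = t := e.apply_symm_apply t
  apply Complex.ext
  · exact congrArg Subtype.val h1
  · rw [Complex.ofReal_im]
    exact h.im_eq_zero _ (hmem _ (e.symm t).2) (Complex.ofReal_im _)

/-- Error bound for the exponential sum obtained from Gaussian quadrature in the variable that
uniformizes an elliptic region onto the right half-plane. -/
lemma exists_expSum_of_isSlitMap {a b h r : ℝ} (hab : a < b) (hh : 0 < h) {φ : ℂ → ℂ}
    (hφ : IsSlitMap a b (2 * Real.cosh h) φ) (hr : Real.exp (-h) < r) (hr1 : r < 1)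
    {M : ℕ} (hM : 1 ≤ M) {T : Set ℝ} (hTab : T ⊆ Set.Icc a b)
    (hT : ((M + 1 : ℕ) : ℕ∞) ≤ T.encard) {f : ℝ → ℝ} {L : C(Set.Icc a b, ℝ) →ₗ[ℝ] ℝ}
    (hnonneg : ∀ ψ : C(Set.Icc a b, ℝ), (∀ x, 0 ≤ ψ x) → 0 ≤ L ψ)
    (hpos : ∀ c : Set.Icc a b, (c : ℝ) ∈ T → ∀ ψ : C(Set.Icc a b, ℝ), (∀ x, 0 ≤ ψ x) → 0 < ψ c →
      0 < L ψ)
    (hLf : ∀ x : ℝ, 0 ≤ x → L ((expKernel x).restrict (Set.Icc a b)) = f x) :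
    ∃ G ∈ expSums M, ∀ x : ℝ, 0 ≤ x →
      |f x - G x| ≤ 2 * (2 * r ^ (2 * M) + r ^ (2 * (2 * M))) * L 1 := by
  have hω : 2 < 2 * Real.cosh h := by
    have := Real.one_lt_cosh.2 hh.ne'
    linarith
  obtain ⟨σ, hσmem, hσ⟩ := hφ.exists_inverse hω
  have hσinj : Function.Injective σ := fun s t hst => by
    have := (hσ s).symm.trans ((congrArg (fun x : ℝ => φ x) hst).trans (hσ t))
    exact Subtype.ext (by exact_mod_cast this)
  set A : Polynomial ℝ →ₗ[ℝ] ℝ := L ∘ₗ (Polynomial.aeval σ).toLinearMap with hA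
  have hAapply : ∀ P, A P = L (Polynomial.aeval σ P) := fun P => rfl
  have haeval : ∀ (P : Polynomial ℝ) t, Polynomial.aeval σ P t = P.eval (σ t) :=
    fun P t => Polynomial.aeval_continuousMap_apply P σ t
  obtain ⟨s, w, hs, hw, hquad⟩ := exists_gauss_quadrature A hM
    (fun P hP => hnonneg _ fun t => by rw [AlgHom.toLinearMap_apply, haeval]; exact hP _ (hσmem t))
    (fun P hP hdeg => by
      have hinj : Set.InjOn (Set.IccExtend hab.le σ) T := fun x hx y hy hxy => by
        rw [Set.IccExtend_of_mem _ _ (hTab hx), Set.IccExtend_of_mem _ _ (hTab hy)] at hxy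
        exact congrArg Subtype.val (hσinj hxy)
      obtain ⟨c, hc, hPc⟩ := exists_eval_ne_zero_of_encard hT hinj hP
        (Polynomial.natDegree_le_of_degree_le hdeg.le)
      rw [Set.IccExtend_of_mem _ _ (hTab hc)] at hPc
      refine hpos ⟨c, hTab hc⟩ hc _ (fun t => ?_) ?_
      · rw [AlgHom.toLinearMap_apply, haeval, Polynomial.eval_mul]
        exact mul_self_nonneg _
      · rw [AlgHom.toLinearMap_apply, haeval, Polynomial.eval_mul]
        exact mul_self_pos.2 hPc)
  have hmem : ∀ x ∈ Set.Icc (-1 : ℝ) 1, (x : ℂ) ∈ ellipseRegion (2 * Real.cosh h) := fun x hx =>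
    ofReal_mem_ellipseRegion hω (abs_le.2 hx)
  have hreal : ∀ x ∈ Set.Icc (-1 : ℝ) 1, φ x = ((φ x).re : ℂ) := fun x hx =>
    Complex.ext (by simp) (by simp [hφ.im_eq_zero _ (hmem x hx) (Complex.ofReal_im x)])
  refine ⟨fun x => ∑ ν, w ν * Real.exp (-((φ (s ν)).re * x)), ⟨w, fun ν => (φ (s ν)).re,
    fun _ => rfl⟩, fun x hx => ?_⟩
  set δ := 2 * r ^ (2 * M) + r ^ (2 * (2 * M))
  obtain ⟨P, hPdeg, hP⟩ := exists_polynomial_approx (F := fun s => Complex.exp (-(x * φ s))) hh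
    ((hφ.differentiableOn.const_mul (x : ℂ)).neg.cexp) (fun z hz => by
      rw [Complex.norm_exp, Complex.neg_re, Complex.re_ofReal_mul]
      have := hφ.re_pos z hz
      exact Real.exp_le_one_iff.2 (neg_nonpos.2 (by positivity))) (n := 2 * M) (by omega) hr hr1
  have hF : ∀ y ∈ Set.Icc (-1 : ℝ) 1,
      (Complex.exp (-(x * φ y))).re = Real.exp (-((φ y).re * x)) := by
    intro y hy
    rw [hreal y hy, Complex.ofReal_re, mul_comm, ← Complex.ofReal_mul, ← Complex.ofReal_neg,
      Complex.exp_ofReal_re]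
  have h1 : |f x - A P| ≤ δ * L 1 := by
    rw [← hLf x hx, hAapply]
    refine abs_functional_sub_le hnonneg fun t => ?_
    have h2 := hP _ (hσmem t)
    rw [hF _ (hσmem t), hσ t, Complex.ofReal_re] at h2
    rw [haeval]
    simp only [mul_comm (t : ℝ)] at h2
    exact h2
  have hw1 : ∑ ν, w ν = L 1 := by
    have h2 := hquad 1 (by rw [Polynomial.natDegree_one]; omega)
    rw [hAapply, map_one] at h2
    simpa using h2.symm
  have h2 : |A P - ∑ ν, w ν * Real.exp (-((φ (s ν)).re * x))| ≤ δ * L 1 := by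
    rw [hquad P hPdeg, ← Finset.sum_sub_distrib, ← hw1, Finset.mul_sum]
    refine (Finset.abs_sum_le_sum_abs _ _).trans (Finset.sum_le_sum fun ν _ => ?_)
    have h3 := hP _ (hs ν)
    rw [hF _ (hs ν), abs_sub_comm] at h3
    rw [← mul_sub, abs_mul, abs_of_nonneg (hw ν), mul_comm]
    exact mul_le_mul_of_nonneg_right h3 (hw ν)
  calc _ ≤ _ := abs_sub_le _ (A P) _
    _ ≤ δ * L 1 + δ * L 1 := add_le_add h1 h2
    _ = 2 * δ * L 1 := by ring

lemma exists_radius {r : ℝ} (hr0 : 0 < r) (hr1 : r < 1) {n : ℕ}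
    (hn : r ^ n < Real.pi / 16) :
    ∃ r' : ℝ, r < r' ∧ r' < 1 ∧ 2 * r' ^ n + r' ^ (2 * n) < 8 / Real.pi * r ^ n := by
  have hpi := Real.pi_pos
  have hpi2 := Real.pi_lt_d2
  have hrn : 0 < r ^ n := by positivity
  have hlt : 2 * r ^ n + r ^ (2 * n) < 8 / Real.pi * r ^ n := by
    have h1 : 2 + r ^ n < 8 / Real.pi := by
      rw [lt_div_iff₀ hpi]
      nlinarith
    rw [mul_comm 2 n, pow_mul]
    nlinarith
  have hcont : Continuous fun x : ℝ => 2 * x ^ n + x ^ (2 * n) := by fun_prop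
  have hev := (hcont.tendsto r).eventually (gt_mem_nhds hlt)
  have hev2 := (hev.and (gt_mem_nhds hr1)).filter_mono (nhdsWithin_le_nhds (s := Set.Ioi r))
  obtain ⟨r', ⟨h1, h2⟩, h3⟩ := (hev2.and self_mem_nhdsWithin).exists
  exact ⟨r', h3, h2, h1⟩

theorem mainTheorem3 (a b : ℝ) (ha : 0 < a) (hab : a < b) (M : ℕ) (hM : 1 ≤ M)
    (W : ℝ → ℝ) (hW : MonotoneOn W (Set.Icc a b))
    (hinc : ((M + 1 : ℕ) : ℕ∞) ≤ (pointsOfIncrease W a b).encard)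
    (f : ℝ → ℝ)
    (hf : ∀ x : ℝ, 0 ≤ x → HasStieltjesIntegral (fun t => Real.exp (-(x * t))) W a b (f x))
    (ρ : ℝ)
    (hρ : ρ = Real.exp
      (Real.pi * (ellipticK (a / b) / ellipticK (Real.sqrt (1 - (a / b) ^ 2))))) :
    0 < bestUniformError f (expSums M) (Set.Ici 0) ∧
      bestUniformError f (expSums M) (Set.Ici 0) <
        ENNReal.ofReal (16 / Real.pi * ρ ^ (-(2 * (M : ℤ))) * f 0) := by
  obtain ⟨L, hnonneg, hint, hpos⟩ := exists_stieltjes_functional hab hW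
  have hTab : pointsOfIncrease W a b ⊆ Set.Icc a b := fun c hc => hc.1
  have hLf : ∀ x : ℝ, 0 ≤ x → L ((expKernel x).restrict (Set.Icc a b)) = f x := fun x hx =>
    hint (expKernel x) (f x) (hf x hx)
  have hpi := Real.pi_pos
  refine ⟨bestUniformError_pos (det_hankelMatrix_ne_zero hTab hinc hpos hLf), ?_⟩
  have hL1 : L 1 = f 0 := by
    rw [← hLf 0 le_rfl]
    congr 1
    ext x
    simp [expKernel]
  have hf0 : 0 < f 0 := by
    obtain ⟨c, hc, -⟩ := exists_eval_ne_zero_of_encard hinc (Set.injOn_id _)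
      (one_ne_zero (α := Polynomial ℝ)) (by simp)
    rw [← hL1]
    exact hpos ⟨c, hTab hc⟩ hc 1 (fun _ => zero_le_one) zero_lt_one
  set H := decayRate a b with hH
  have hHpos : 0 < H := decayRate_pos ha hab
  set r := Real.exp (-H) with hr
  have hr0 : 0 < r := Real.exp_pos _
  have hr1 : r < 1 := Real.exp_lt_one_iff.2 (by linarith)
  have hpow : ρ ^ (-(2 * (M : ℤ))) = r ^ (2 * M) := by
    rw [hρ, hr, Real.exp_neg, inv_pow, zpow_neg]
    congr 1
  rw [hpow]
  rcases lt_or_ge (r ^ (2 * M)) (Real.pi / 16) with hsmall | hlarge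
  · obtain ⟨r', h1, h2, h3⟩ := exists_radius hr0 hr1 hsmall
    obtain ⟨q, hq1, hq2⟩ := exists_between h1
    have hq0 : 0 < q := hr0.trans hq1
    have hh : 0 < -Real.log q := by
      have := Real.log_neg hq0 (hq2.trans h2)
      linarith
    have hhH : -Real.log q < H := by
      have := (Real.lt_log_iff_exp_lt hq0).2 hq1
      linarith
    obtain ⟨φ, hφ⟩ := exists_isSlitMap ha hab hh hhH
    obtain ⟨G, hG, hGf⟩ := exists_expSum_of_isSlitMap hab hh hφ
      (r := r') (by rwa [neg_neg, Real.exp_log hq0]) h2 hM hTab hinc hnonneg hpos hLf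
    refine (bestUniformError_le hG hGf).trans_lt
      ((ENNReal.ofReal_lt_ofReal_iff (by positivity)).2 ?_)
    rw [hL1]
    refine mul_lt_mul_of_pos_right ?_ hf0
    calc _ < 2 * (8 / Real.pi * r ^ (2 * M)) := by linarith
      _ = _ := by ring
  · set G : ℝ → ℝ := fun _ => f 0 / 2 with hG
    have hGmem : G ∈ expSums M := by
      refine ⟨fun ν => if ν = ⟨0, hM⟩ then f 0 / 2 else 0, fun _ => 0, fun x => ?_⟩
      simp [hG]
    have hGf : ∀ x : ℝ, 0 ≤ x → |f x - G x| ≤ f 0 / 2 := by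
      intro x hx
      have h1 : 0 ≤ f x := by
        rw [← hLf x hx]
        exact hnonneg _ fun t => (Real.exp_pos _).le
      have h2 : 0 ≤ f 0 - f x := by
        rw [← hLf x hx, ← hL1, ← map_sub]
        refine hnonneg _ fun t => sub_nonneg.2 ?_
        have ht : 0 ≤ (t : ℝ) := ha.le.trans t.2.1
        exact Real.exp_le_one_iff.2 (neg_nonpos.2 (mul_nonneg hx ht))
      exact abs_le.2 ⟨by simp only [hG]; linarith, by simp only [hG]; linarith⟩
    refine (bestUniformError_le hGmem hGf).trans_lt
      ((ENNReal.ofReal_lt_ofReal_iff (by positivity)).2 ?_)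
    have h1 : 1 ≤ 16 / Real.pi * r ^ (2 * M) := by
      rw [div_mul_eq_mul_div, le_div_iff₀ hpi]
      linarith
    nlinarith
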